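/- For $t>0$ put $h_+=\frac{3+\sqrt{9+8t}}{4}$. For $R>0$ let $B(0,R)\subset\mathbb{R}^3$ be the ball of radius $R$ and let $\bar S$ be the space of symmetric traceless real $3\times 3$ matrices. Write $\mathbf r$ for the position vector, $r=|\mathbf r|$, and $\mathbf I$ for the identity matrix. The dimensionless Landau–de Gennes energy at reduced temperature $t$ is $$\mathcal I_{LG}[\mathbf Q]=\int_{B(0,R)}\frac12|\nabla \mathbf Q|^2-\frac12\operatorname{tr}\mathbf Q^2-\frac{\sqrt6\,h_+}{t}\operatorname{tr}\mathbf Q^3+\frac{h_+^2}{2t}\left(\operatorname{tr}\mathbf Q^2\right)^2\,dV,\qquad |\nabla\mathbf Q|^2=\sum_{i,j,k}\left(\frac{\partial \mathbf Q_{ij}}{\partial x_k}\right)^2,$$ on the admissible space $$\mathcal A_{\mathbf Q}=\left\{\mathbf Q\in W^{1,2}(B(0,R);\bar S):\ \mathbf Q=\sqrt{\tfrac32}\left(\tfrac{\mathbf r}{r}\otimes\tfrac{\mathbf r}{r}-\tfrac{\mathbf I}{3}\right)\text{ on }\partial B(0,R)\right\}.$$ Let $\mathcal A_h=\{h\in W^{1,2}([0,R];\mathbb{R}):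 h(R)=1\}$ and $$I[h]=\int_0^R r^2\left(\frac12\left(\frac{dh}{dr}\right)^2+\frac{3h^2}{r^2}+f(h)\right)dr,\qquad f(h)=-\frac{h^2}{2}-\frac{h_+}{t}h^3+\frac{h_+^2}{2t}h^4+C(t),$$ where the constant $C(t)$ is such that $f(1)=0$. A radial-hedgehog solution (for given $t$ and $R$) is a map $$\mathbf Q^*(\mathbf r)=\sqrt{\tfrac32}\,h^*(r)\left(\frac{\mathbf r\otimes\mathbf r}{r^2}-\frac13\mathbf I\right),$$ where $h^*$ is a global minimizer of $I$ in $\mathcal A_h$. **Proposition.** (i) There are $t_0,R_0>0$ such that for all $t\ge t_0$ and all $R\ge R_0$, every radial-hedgehog solution $\mathbf Q^*$ belongs to $\mathcal A_{\mathbf Q}$ and is not a global minimizer of $\mathcal I_{LG}$ in $\mathcal A_{\mathbf Q}$. (ii) Let $t=200$ and $\sigma=10$. There is $R_0\ge\sigma$ such that for all $R\ge R_0$ and every radial-hedgehog solution $\mathbf Q^*$, the map $$\hat{\mathbf Q}(\mathbf r)=\begin{cases}\mathbf Q^*(\mathbf r)+\dfrac{1}{(r^2+12)^2}\left(1-\dfrac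 r\sigma\right)\left(\mathbf z\otimes\mathbf z-\dfrac{\mathbf I}{3}\right), & 0\le r\le\sigma,\\[2mm] \mathbf Q^*(\mathbf r), & \sigma\le r\le R,\end{cases}\qquad \mathbf z=(0,0,1),$$ belongs to $\mathcal A_{\mathbf Q}$, as does $\mathbf Q^*$, and $$\mathcal I_{LG}[\hat{\mathbf Q}]<\mathcal I_{LG}[\mathbf Q^*].$$ In particular $\mathbf Q^*$ is not a global minimizer of $\mathcal I_{LG}$ in $\mathcal A_{\mathbf Q}$. -/

import Mathlib

open MeasureTheory Set
open scoped ContDiff ENNReal Matrix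

noncomputable section

namespace LandauDeGennes

/-- Physical space `ℝ³` with the Euclidean norm. -/
abbrev Space := EuclideanSpace ℝ (Fin 3)

/-- Real `3 × 3` matrices. -/
abbrev Mat := Matrix (Fin 3) (Fin 3) ℝ

/-! ### Sobolev spaces on open subsets of `ℝ³` -/

/-- The classical partial derivative `∂φ/∂x_k`. -/
def partialDeriv (k : Fin 3) (φ : Space → ℝ) (x : Space) : ℝ :=
  fderiv ℝ φ x (EuclideanSpace.single k 1)

/-- Test functions: `φ ∈ C_c^∞(Ω)`. -/
def IsTest (Ω : Set Space) (φ : Space → ℝ) : Prop :=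
  ContDiff ℝ ∞ φ ∧ HasCompactSupport φ ∧ tsupport φ ⊆ Ω

/-- `v ∈ L²(Ω)` is a weak partial derivative `∂u/∂x_k` of `u` in `Ω`. -/
def IsWeakPartial (Ω : Set Space) (k : Fin 3) (u v : Space → ℝ) : Prop :=
  MemLp v 2 (volume.restrict Ω) ∧
    ∀ φ : Space → ℝ, IsTest Ω φ →
      ∫ x in Ω, u x * partialDeriv k φ x = -∫ x in Ω, v x * φ x

/-- `u ∈ W^{1,2}(Ω)`. -/
def MemW12 (Ω : Set Space) (u : Space → ℝ) : Prop :=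
  MemLp u 2 (volume.restrict Ω) ∧ ∀ k : Fin 3, ∃ v : Space → ℝ, IsWeakPartial Ω k u v

open Classical in
/-- The weak partial derivative `∂u/∂x_k` in `Ω` of a function `u ∈ W^{1,2}(Ω)`; it is unique
up to equality almost everywhere in `Ω`. -/
def weakPartial (Ω : Set Space) (k : Fin 3) (u : Space → ℝ) : Space → ℝ :=
  if hu : ∃ v : Space → ℝ, IsWeakPartial Ω k u v then hu.choose else 0

/-- `u ∈ W_0^{1,2}(Ω)`, the closure of `C_c^∞(Ω)` in `W^{1,2}(Ω)`. -/
def MemW12Zero (Ω : Set Space) (u : Space → ℝ) : Prop :=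
  MemW12 Ω u ∧
    ∀ ε : ℝ≥0∞, 0 < ε → ∃ φ : Space → ℝ, IsTest Ω φ ∧
      eLpNorm (fun x => u x - φ x) 2 (volume.restrict Ω) < ε ∧
      ∀ k : Fin 3,
        eLpNorm (fun x => weakPartial Ω k u x - partialDeriv k φ x) 2 (volume.restrict Ω) < ε

/-! ### The Landau-de Gennes energy in dimensionless variables -/

/-- The constant `h_+ = (3 + √(9 + 8t)) / 4`. -/
def hPlus (t : ℝ) : ℝ := (3 + √(9 + 8 * t)) / 4

/-- The droplet of radius `R`; its boundary is a null set, so it is taken open. -/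
def droplet (R : ℝ) : Set Space := Metric.ball 0 R

/-- `|∇Q|² = ∑_{i,j,k} (∂Q_ij/∂x_k)²`, with weak derivatives in the droplet. -/
def gradSq (R : ℝ) (Q : Space → Mat) (x : Space) : ℝ :=
  ∑ i : Fin 3, ∑ j : Fin 3, ∑ k : Fin 3,
    (weakPartial (droplet R) k (fun y => Q y i j) x) ^ 2

/-- The dimensionless Landau-de Gennes energy of `Q` on the droplet of radius `R` at the reduced
temperature `t`. -/
def energy (t R : ℝ) (Q : Space → Mat) : ℝ :=
  ∫ x in droplet R,
    (1 / 2 * gradSq R Q x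
      - 1 / 2 * (Q x ^ 2).trace
      - √6 * hPlus t / t * (Q x ^ 3).trace
      + hPlus t ^ 2 / (2 * t) * (Q x ^ 2).trace ^ 2)

/-- `(r ⊗ r) / |r|² - I / 3`. -/
def radialTensor (x : Space) : Mat :=
  (1 / ‖x‖ ^ 2) • Matrix.vecMulVec x x - (1 / 3 : ℝ) • (1 : Mat)

/-- `z ⊗ z - I / 3` with `z = (0, 0, 1)`. -/
def axialTensor : Mat :=
  Matrix.vecMulVec ![0, 0, 1] ![0, 0, 1] - (1 / 3 : ℝ) • (1 : Mat)

/-- The tensor field `√(3/2) h(r) ((r ⊗ r) / r² - I / 3)` with scalar order parameter `h`. -/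
def hedgehog (h : ℝ → ℝ) (x : Space) : Mat :=
  (√(3 / 2) * h ‖x‖) • radialTensor x

/-- The admissible space: symmetric traceless `Q ∈ W^{1,2}` on the droplet, equal to
`√(3/2) ((r ⊗ r) / r² - I / 3)` on the boundary sphere. The right-hand side, taken on the whole
droplet, is a `W^{1,2}` extension of the boundary datum, and the boundary condition is that the
difference lies in `W_0^{1,2}`. -/
def admissible (R : ℝ) : Set (Space → Mat) :=
  {Q | (∀ i j : Fin 3, MemW12 (droplet R) (fun x => Q x i j)) ∧
    (∀ᵐ x ∂(volume.restrict (droplet R)), (Q x).IsSymm ∧ (Q x).trace = 0) ∧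
    ∀ i j : Fin 3, MemW12Zero (droplet R) (fun x => Q x i j - hedgehog (fun _ => 1) x i j)}

/-! ### The radial problem -/

/-- The bulk potential `f(h) = -h²/2 - (h_+/t) h³ + (h_+²/(2t)) h⁴ + C(t)`, where the additive
constant `C(t)` is the one for which `f(1) = 0`. -/
def radialPotential (t s : ℝ) : ℝ :=
  -s ^ 2 / 2 - hPlus t / t * s ^ 3 + hPlus t ^ 2 / (2 * t) * s ^ 4
    + (1 / 2 + hPlus t / t - hPlus t ^ 2 / (2 * t))

/-- The radial energy `I[h] = ∫₀ᴿ r² (h'(r)² / 2 + 3 h(r)² / r² + f(h(r))) dr`. -/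
def radialEnergy (t R : ℝ) (h : ℝ → ℝ) : ℝ :=
  ∫ r in (0 : ℝ)..R,
    r ^ 2 * (1 / 2 * deriv h r ^ 2 + 3 * h r ^ 2 / r ^ 2 + radialPotential t (h r))

/-- The functions `h ∈ W^{1,2}([0, R])` with `h(R) = 1`. A `W^{1,2}` function of one variable is
taken as its continuous representative: an absolutely continuous function with square-integrable
derivative. -/
def radialAdmissible (R : ℝ) : Set (ℝ → ℝ) :=
  {h | AbsolutelyContinuousOnInterval h 0 R ∧
    MemLp (deriv h) 2 (volume.restrict (Ioo 0 R)) ∧ h R = 1}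

/-- `h` is a global minimizer of the radial energy; `hedgehog h` is then a radial-hedgehog
solution. -/
def IsHedgehogProfile (t R : ℝ) (h : ℝ → ℝ) : Prop :=
  h ∈ radialAdmissible R ∧ IsMinOn (radialEnergy t R) (radialAdmissible R) h

/-- The perturbed state, equal to
`Q* + (r² + 12)⁻² (1 - r/σ) (z ⊗ z - I / 3)` for `r ≤ σ` and to `Q*` for `r ≥ σ`, where
`Q* = hedgehog h`. -/
def biaxialState (h : ℝ → ℝ) (σ : ℝ) (x : Space) : Mat :=
  if ‖x‖ ≤ σ then
    hedgehog h x + (1 / (‖x‖ ^ 2 + 12) ^ 2 * (1 - ‖x‖ / σ)) • axialTensor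
  else hedgehog h x

end LandauDeGennes

end

namespace LandauDeGennes

/-! The hedgehog core is an almost isotropic region in which the bulk term `-tr Q² / 2` rewards
ordering. A small uniaxial field `w(r) Z`, `Z = z ⊗ z - I/3`, added there gains more bulk energy
than it costs in gradient, provided that the profile `h` is small enough near the origin. Both parts
follow from one strict inequality, valid for all `t ≥ 200` and `R ≥ 10`.

The energy difference is exact, not a truncated second variation. The integrand depends on the
direction only through `τ = (x₂/|x|)² - 1/3`, as a polynomial of degree two. The mean of `τ` over
spheres is `0`, which removes every term odd in the interaction of `w` with `h`, including the one
containing `h'`; the mean of `τ²` is `4/45`. What remains in `energy_perturbedState` is a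
one-dimensional integral, and `density_sub_le` bounds the change of its integrand by `(1/3)(w'² -
0.9999 w² + 1.6268 ρ² w²)` whenever `|h| ≤ ρ`.

The bound `|h| ≤ ρ` with an explicit rational `ρ` is `IsHedgehogProfile.abs_le_barrier`. No
Euler-Lagrange equation or regularity of `h` is used: `h` is compared with its competitor `min |h|
ρ`. With `p = r² ρ'/ρ`, subtracting the exact derivative of `p h²/2` turns the radial density into a
square plus `r² (f(h) + q h²/2)`, where `q = -(ρ'' + 2ρ'/r - 6ρ/r²)/ρ`. The square vanishes where
the competitor is `ρ`, and `s ↦ f(s) + q s²/2` increases strictly on `[ρ, ∞)`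
(`radialPotential_strictMonoOn`), so truncation would lower the energy unless `|h| ≤ ρ` almost
everywhere.

The remaining integral with the prescribed `w` is negative by an explicit primitive
(`integral_trialIntegrand_neg`). Admissibility, and the identification of weak derivatives, rest on
approximating `g(|x|) A(x)`, with `A` homogeneous-like of degree zero, by test functions
(`isTestLimit_radial_mul`). -/

/-! ### Test functions and calculus of weak derivatives. -/

lemma IsTest.continuous_partialDeriv {Ω : Set Space} {φ : Space → ℝ} (hφ : IsTest Ω φ)
    (k : Fin 3) : Continuous (partialDeriv k φ) :=
  (hφ.1.continuous_fderiv (by simp)).clm_apply continuous_const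

lemma IsTest.hasCompactSupport_partialDeriv {Ω : Set Space} {φ : Space → ℝ} (hφ : IsTest Ω φ)
    (k : Fin 3) : HasCompactSupport (partialDeriv k φ) :=
  hφ.2.1.fderiv_apply (𝕜 := ℝ) _

lemma IsTest.memLp {Ω : Set Space} {φ : Space → ℝ} (hφ : IsTest Ω φ) (μ : Measure Space)
    [IsFiniteMeasureOnCompacts μ] : MemLp φ 2 μ :=
  hφ.1.continuous.memLp_of_hasCompactSupport hφ.2.1

lemma IsTest.memLp_partialDeriv {Ω : Set Space} {φ : Space → ℝ} (hφ : IsTest Ω φ) (k : Fin 3)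
    (μ : Measure Space) [IsFiniteMeasureOnCompacts μ] : MemLp (partialDeriv k φ) 2 μ :=
  (hφ.continuous_partialDeriv k).memLp_of_hasCompactSupport (hφ.hasCompactSupport_partialDeriv k)

lemma IsTest.mono {Ω Ω' : Set Space} (h : Ω ⊆ Ω') {φ : Space → ℝ} (hφ : IsTest Ω φ) :
    IsTest Ω' φ := ⟨hφ.1, hφ.2.1, hφ.2.2.trans h⟩

lemma IsTest.add {Ω : Set Space} {φ ψ : Space → ℝ} (hφ : IsTest Ω φ) (hψ : IsTest Ω ψ) :
    IsTest Ω (φ + ψ) :=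
  ⟨hφ.1.add hψ.1, hφ.2.1.add hψ.2.1,
    (tsupport_add φ ψ).trans (union_subset hφ.2.2 hψ.2.2)⟩

lemma IsTest.const_smul {Ω : Set Space} {φ : Space → ℝ} (hφ : IsTest Ω φ) (c : ℝ) :
    IsTest Ω (c • φ) :=
  ⟨contDiff_const.smul hφ.1, hφ.2.1.smul_left (f := fun _ => c),
    (tsupport_smul_subset_right (fun _ => c) φ).trans hφ.2.2⟩

lemma IsTest.partialDeriv_eq_zero {Ω : Set Space} {φ : Space → ℝ} (hφ : IsTest Ω φ) (k : Fin 3)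
    {x : Space} (hx : x ∉ Ω) : partialDeriv k φ x = 0 := by
  have : x ∉ tsupport (fderiv ℝ φ) := fun h => hx (hφ.2.2 (tsupport_fderiv_subset ℝ h))
  simp [partialDeriv, image_eq_zero_of_notMem_tsupport this]

lemma IsTest.eq_zero {Ω : Set Space} {φ : Space → ℝ} (hφ : IsTest Ω φ)
    {x : Space} (hx : x ∉ Ω) : φ x = 0 :=
  image_eq_zero_of_notMem_tsupport fun h => hx (hφ.2.2 h)

/-- Integration by parts for two test functions. -/
lemma IsTest.integral_mul_partialDeriv {Ω : Set Space} {φ ψ : Space → ℝ} (hφ : IsTest Ω φ)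
    (hψ : IsTest Ω ψ) (k : Fin 3) :
    ∫ x in Ω, φ x * partialDeriv k ψ x = -∫ x in Ω, partialDeriv k φ x * ψ x := by
  rw [setIntegral_eq_integral_of_forall_compl_eq_zero (fun x hx => by rw [hφ.eq_zero hx, zero_mul]),
    setIntegral_eq_integral_of_forall_compl_eq_zero
      (fun x hx => by rw [hψ.eq_zero hx, mul_zero])]
  exact integral_mul_fderiv_eq_neg_fderiv_mul_of_integrable
    ((hφ.memLp_partialDeriv k _).integrable_mul (hψ.memLp volume))
    ((hφ.memLp volume).integrable_mul (hψ.memLp_partialDeriv k _))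
    ((hφ.memLp volume).integrable_mul (hψ.memLp volume))
    (fun x _ => hφ.1.contDiffAt.differentiableAt (by simp))
    (fun x _ => hψ.1.contDiffAt.differentiableAt (by simp))

lemma IsWeakPartial.ae_eq {Ω : Set Space} (hΩ : IsOpen Ω) {k : Fin 3} {u v v' : Space → ℝ}
    (hv : IsWeakPartial Ω k u v) (hv' : IsWeakPartial Ω k u v') :
    v =ᵐ[volume.restrict Ω] v' := by
  have hloc : LocallyIntegrableOn (fun x => v x - v' x) Ω volume := by
    have := ((hv.1.sub hv'.1).locallyIntegrable (by norm_num))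
    exact locallyIntegrableOn_of_locallyIntegrable_restrict this
  have := hΩ.ae_eq_zero_of_integral_contDiff_smul_eq_zero hloc fun φ h1 h2 h3 => by
    have hφ : IsTest Ω φ := ⟨h1, h2, h3⟩
    have e1 := hv.2 φ hφ
    have e2 := hv'.2 φ hφ
    have hs : ∫ x, φ x • (v x - v' x) = ∫ x in Ω, φ x • (v x - v' x) :=
      (setIntegral_eq_integral_of_forall_compl_eq_zero
        (fun x hx => by rw [hφ.eq_zero hx, zero_smul])).symm
    rw [hs]
    have hi := hv.1.integrable_mul (hφ.memLp (volume.restrict Ω))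
    have hi' := hv'.1.integrable_mul (hφ.memLp (volume.restrict Ω))
    calc ∫ x in Ω, φ x • (v x - v' x) = ∫ x in Ω, (v x * φ x - v' x * φ x) := by
          congr 1; ext x; simp only [smul_eq_mul]; ring
      _ = (∫ x in Ω, v x * φ x) - ∫ x in Ω, v' x * φ x := integral_sub hi hi'
      _ = 0 := by linarith
  rw [Filter.EventuallyEq, ae_restrict_iff' hΩ.measurableSet]
  filter_upwards [this] with x hx hxΩ
  linarith [hx hxΩ]

lemma IsWeakPartial.weakPartial_ae_eq {Ω : Set Space} (hΩ : IsOpen Ω) {k : Fin 3}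
    {u v : Space → ℝ} (hv : IsWeakPartial Ω k u v) :
    weakPartial Ω k u =ᵐ[volume.restrict Ω] v := by
  have hu : ∃ v : Space → ℝ, IsWeakPartial Ω k u v := ⟨v, hv⟩
  rw [weakPartial, dif_pos hu]
  exact hu.choose_spec.ae_eq hΩ hv

lemma IsWeakPartial.add {Ω : Set Space} {k : Fin 3} {u v u' v' : Space → ℝ}
    (hu : MemLp u 2 (volume.restrict Ω)) (hu' : MemLp u' 2 (volume.restrict Ω))
    (h : IsWeakPartial Ω k u v) (h' : IsWeakPartial Ω k u' v') :
    IsWeakPartial Ω k (u + u') (v + v') := by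
  refine ⟨h.1.add h'.1, fun φ hφ => ?_⟩
  simp only [Pi.add_apply, add_mul]
  have i1 := hφ.memLp (volume.restrict Ω)
  have i2 := hφ.memLp_partialDeriv k (volume.restrict Ω)
  have e1 := integral_add (hu.integrable_mul i2) (hu'.integrable_mul i2)
  have e2 := integral_add (h.1.integrable_mul i1) (h'.1.integrable_mul i1)
  simp only [Pi.mul_apply] at e1 e2
  rw [e1, e2, h.2 φ hφ, h'.2 φ hφ]; ring

lemma IsWeakPartial.const_smul {Ω : Set Space} {k : Fin 3} {u v : Space → ℝ}
    (h : IsWeakPartial Ω k u v) (c : ℝ) : IsWeakPartial Ω k (c • u) (c • v) := by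
  refine ⟨h.1.const_smul c, fun φ hφ => ?_⟩
  simp only [Pi.smul_apply, smul_eq_mul, mul_assoc, integral_const_mul, h.2 φ hφ]; ring

lemma IsWeakPartial.mono {Ω Ω' : Set Space} (hΩ : Ω ⊆ Ω') (hm : MeasurableSet Ω') {k : Fin 3}
    {u v : Space → ℝ} (h : IsWeakPartial Ω' k u v) : IsWeakPartial Ω k u v := by
  refine ⟨h.1.mono_measure (Measure.restrict_mono hΩ le_rfl), fun φ hφ => ?_⟩
  have e := h.2 φ (hφ.mono hΩ)
  rwa [setIntegral_eq_of_subset_of_forall_sdiff_eq_zero hm hΩ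
      (fun x hx => by rw [hφ.partialDeriv_eq_zero k hx.2, mul_zero]),
    setIntegral_eq_of_subset_of_forall_sdiff_eq_zero hm hΩ
      (fun x hx => by rw [hφ.eq_zero hx.2, mul_zero])] at e

lemma IsWeakPartial.congr {Ω : Set Space} (hm : MeasurableSet Ω) {k : Fin 3}
    {u v u' v' : Space → ℝ} (h : IsWeakPartial Ω k u v) (hu : EqOn u' u Ω) (hv : EqOn v' v Ω) :
    IsWeakPartial Ω k u' v' := by
  refine ⟨h.1.ae_eq ((ae_restrict_mem hm).mono fun x hx => (hv hx).symm), fun φ hφ => ?_⟩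
  have e1 : ∫ x in Ω, u' x * partialDeriv k φ x = ∫ x in Ω, u x * partialDeriv k φ x :=
    setIntegral_congr_fun hm fun x hx => by simp only [hu hx]
  have e2 : ∫ x in Ω, v' x * φ x = ∫ x in Ω, v x * φ x :=
    setIntegral_congr_fun hm fun x hx => by simp only [hv hx]
  rw [e1, e2, h.2 φ hφ]

/-! ### Strong limits of test functions. -/

/-- `u` and the `v k` are the simultaneous `L²` limits of test functions and their partial
derivatives. -/
def IsTestLimit (Ω : Set Space) (u : Space → ℝ) (v : Fin 3 → Space → ℝ) : Prop :=
  MemLp u 2 (volume.restrict Ω) ∧ (∀ k, MemLp (v k) 2 (volume.restrict Ω)) ∧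
    ∀ ε : ℝ≥0∞, 0 < ε → ∃ φ : Space → ℝ, IsTest Ω φ ∧
      eLpNorm (fun x => u x - φ x) 2 (volume.restrict Ω) < ε ∧
      ∀ k : Fin 3, eLpNorm (fun x => v k x - partialDeriv k φ x) 2 (volume.restrict Ω) < ε

lemma enorm_integral_mul_le_eLpNorm {α : Type*} [MeasurableSpace α] {μ : Measure α} {f g : α → ℝ}
    (hf : AEStronglyMeasurable f μ) (hg : AEStronglyMeasurable g μ) :
    ‖∫ x, f x * g x ∂μ‖ₑ ≤ eLpNorm f 2 μ * eLpNorm g 2 μ := by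
  refine (enorm_integral_le_lintegral_enorm _).trans ?_
  rw [← eLpNorm_one_eq_lintegral_enorm]
  change eLpNorm (f * g) 1 μ ≤ _
  simpa only [smul_eq_mul] using eLpNorm_smul_le_mul_eLpNorm (p := 2) (q := 2) (r := 1) hg hf

/-- Integration by parts holds for the approximating test functions, and both sides are continuous
in `L²` by Cauchy-Schwarz. Hence one approximation argument yields the weak derivatives and
membership in `W_0^{1,2}` together. -/
lemma IsTestLimit.isWeakPartial {Ω : Set Space} {u : Space → ℝ} {v : Fin 3 → Space → ℝ}
    (h : IsTestLimit Ω u v) (k : Fin 3) : IsWeakPartial Ω k u (v k) := by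
  refine ⟨h.2.1 k, fun ψ hψ => ?_⟩
  set μ := volume.restrict Ω
  have m0 := hψ.memLp μ
  have m1 := hψ.memLp_partialDeriv k μ
  set S := (∫ x, u x * partialDeriv k ψ x ∂μ) + ∫ x, v k x * ψ x ∂μ with hS
  have key : ∀ ε : ℝ≥0∞, 0 < ε →
      ‖S‖ₑ ≤ ε * (eLpNorm (partialDeriv k ψ) 2 μ + eLpNorm ψ 2 μ) := by
    intro ε hε
    obtain ⟨φ, hφ, h1, h2⟩ := h.2.2 ε hε
    have n0 := hφ.memLp μ
    have n1 := hφ.memLp_partialDeriv k μ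
    have e : S = (∫ x, (u x - φ x) * partialDeriv k ψ x ∂μ)
        + ∫ x, (v k x - partialDeriv k φ x) * ψ x ∂μ := by
      have e1 := integral_sub (h.1.integrable_mul m1) (n0.integrable_mul m1)
      have e2 := integral_sub ((h.2.1 k).integrable_mul m0) (n1.integrable_mul m0)
      simp only [Pi.mul_apply] at e1 e2
      simp only [sub_mul]
      rw [e1, e2, hS, hφ.integral_mul_partialDeriv hψ k]; ring
    rw [e, mul_add]
    refine (enorm_add_le _ _).trans (add_le_add ?_ ?_)
    · exact (enorm_integral_mul_le_eLpNorm (h.1.sub n0).1 m1.1).trans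
        (mul_le_mul_left h1.le _)
    · exact (enorm_integral_mul_le_eLpNorm ((h.2.1 k).sub n1).1 m0.1).trans
        (mul_le_mul_left (h2 k).le _)
  have hfin : eLpNorm (partialDeriv k ψ) 2 μ + eLpNorm ψ 2 μ ≠ ⊤ :=
    ENNReal.add_ne_top.2 ⟨m1.2.ne, m0.2.ne⟩
  have hS0 : ‖S‖ₑ ≤ 0 := by
    have ht : Filter.Tendsto (fun n : ℕ => (n : ℝ≥0∞)⁻¹ *
        (eLpNorm (partialDeriv k ψ) 2 μ + eLpNorm ψ 2 μ)) Filter.atTop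
        (nhds (0 * (eLpNorm (partialDeriv k ψ) 2 μ + eLpNorm ψ 2 μ))) :=
      ENNReal.Tendsto.mul_const ENNReal.tendsto_inv_nat_nhds_zero (Or.inr hfin)
    rw [zero_mul] at ht
    exact ge_of_tendsto' ht fun n => key _ (by simp)
  have : S = 0 := by simpa using hS0
  linarith

lemma IsTestLimit.memW12Zero {Ω : Set Space} (hΩ : IsOpen Ω) {u : Space → ℝ}
    {v : Fin 3 → Space → ℝ} (h : IsTestLimit Ω u v) : MemW12Zero Ω u := by
  refine ⟨⟨h.1, fun k => ⟨v k, h.isWeakPartial k⟩⟩, fun ε hε => ?_⟩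
  obtain ⟨φ, hφ, h1, h2⟩ := h.2.2 ε hε
  refine ⟨φ, hφ, h1, fun k => ?_⟩
  rw [eLpNorm_congr_ae (g := fun x => v k x - partialDeriv k φ x)]
  · exact h2 k
  · filter_upwards [(h.isWeakPartial k).weakPartial_ae_eq hΩ] with x hx
    rw [hx]

lemma partialDeriv_add {φ ψ : Space → ℝ} {x : Space} (hφ : DifferentiableAt ℝ φ x)
    (hψ : DifferentiableAt ℝ ψ x) (k : Fin 3) :
    partialDeriv k (φ + ψ) x = partialDeriv k φ x + partialDeriv k ψ x := by
  simp [partialDeriv, fderiv_add hφ hψ]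

lemma IsTest.differentiable {Ω : Set Space} {φ : Space → ℝ} (hφ : IsTest Ω φ) :
    Differentiable ℝ φ := hφ.1.differentiable (by simp)

lemma IsTestLimit.add {Ω : Set Space} {u u' : Space → ℝ} {v v' : Fin 3 → Space → ℝ}
    (h : IsTestLimit Ω u v) (h' : IsTestLimit Ω u' v') : IsTestLimit Ω (u + u') (v + v') := by
  refine ⟨h.1.add h'.1, fun k => (h.2.1 k).add (h'.2.1 k), fun ε hε => ?_⟩
  obtain ⟨φ, hφ, h1, h2⟩ := h.2.2 (ε / 2) (ENNReal.half_pos hε.ne')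
  obtain ⟨ψ, hψ, h1', h2'⟩ := h'.2.2 (ε / 2) (ENNReal.half_pos hε.ne')
  refine ⟨φ + ψ, hφ.add hψ, ?_, fun k => ?_⟩
  · have e : (fun x => (u + u') x - (φ + ψ) x) = (fun x => u x - φ x) + fun x => u' x - ψ x := by
      ext x; simp only [Pi.add_apply]; ring
    rw [e, ← ENNReal.add_halves ε]
    exact (eLpNorm_add_le (h.1.sub (hφ.memLp _)).1 (h'.1.sub (hψ.memLp _)).1 (by simp)).trans_lt
      (ENNReal.add_lt_add h1 h1')
  · have e : (fun x => (v + v') k x - partialDeriv k (φ + ψ) x)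
        = (fun x => v k x - partialDeriv k φ x) + fun x => v' k x - partialDeriv k ψ x := by
      ext x
      rw [partialDeriv_add (hφ.differentiable x) (hψ.differentiable x)]
      simp only [Pi.add_apply]; ring
    rw [e, ← ENNReal.add_halves ε]
    exact (eLpNorm_add_le ((h.2.1 k).sub (hφ.memLp_partialDeriv k _)).1
      ((h'.2.1 k).sub (hψ.memLp_partialDeriv k _)).1 (by simp)).trans_lt
      (ENNReal.add_lt_add (h2 k) (h2' k))

lemma IsTestLimit.const_smul {Ω : Set Space} {u : Space → ℝ} {v : Fin 3 → Space → ℝ}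
    (h : IsTestLimit Ω u v) (c : ℝ) : IsTestLimit Ω (c • u) (c • v) := by
  refine ⟨h.1.const_smul c, fun k => (h.2.1 k).const_smul c, fun ε hε => ?_⟩
  -- The extra `1` keeps the divisor nonzero when `c = 0`.
  have hc : 0 < ‖c‖ₑ + 1 := by positivity
  have hct : ‖c‖ₑ + 1 ≠ ⊤ := by simp
  obtain ⟨φ, hφ, h1, h2⟩ := h.2.2 (ε / (‖c‖ₑ + 1)) (ENNReal.div_pos hε.ne' hct)
  have aux : ∀ a : ℝ≥0∞, a < ε / (‖c‖ₑ + 1) → ‖c‖ₑ * a < ε := fun a ha => by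
    rw [ENNReal.lt_div_iff_mul_lt (Or.inl hc.ne') (Or.inl hct), mul_comm] at ha
    exact (mul_le_mul_left le_self_add a).trans_lt ha
  refine ⟨c • φ, hφ.const_smul c, ?_, fun k => ?_⟩
  · have e : (fun x => (c • u) x - (c • φ) x) = c • fun x => u x - φ x := by
      ext x; simp only [Pi.smul_apply, smul_eq_mul]; ring
    rw [e, eLpNorm_const_smul]
    exact aux _ h1
  · have e : (fun x => (c • v) k x - partialDeriv k (c • φ) x)
        = c • fun x => v k x - partialDeriv k φ x := by
      ext x
      simp [partialDeriv, fderiv_const_smul (hφ.differentiable x), mul_sub]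
    rw [e, eLpNorm_const_smul]
    exact aux _ (h2 k)

/-! ### Polar coordinates on the ball. -/

/-- The area of the unit sphere in `ℝ³`. -/
noncomputable def sphereArea : ℝ≥0∞ := (volume : Measure Space).toSphere univ

lemma sphereArea_ne_top : sphereArea ≠ ⊤ := measure_ne_top _ _

lemma sphereArea_pos : 0 < sphereArea := by
  rw [sphereArea, Measure.toSphere_apply_univ]
  have : 0 < (volume : Measure Space) (Metric.ball 0 1) := Metric.measure_ball_pos _ _ one_pos
  simp only [finrank_euclideanSpace, Fintype.card_fin]
  exact ENNReal.mul_pos (by simp) this.ne'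

lemma lintegral_fun_norm {f : ℝ → ℝ≥0∞} (hf : Measurable f) :
    ∫⁻ x : Space, f ‖x‖ = sphereArea * ∫⁻ y in Ioi (0 : ℝ), ENNReal.ofReal (y ^ 2) * f y := by
  have hd : Module.finrank ℝ Space - 1 = 2 := by simp
  calc
    ∫⁻ x : Space, f ‖x‖ = ∫⁻ x : ({(0 : Space)}ᶜ : Set Space), f ‖x.1‖
          ∂((volume : Measure Space).comap Subtype.val) := by
      rw [lintegral_subtype_comap (measurableSet_singleton _).compl fun x => f ‖x‖,
        restrict_compl_singleton]
    _ = ∫⁻ x, f x.2 ∂((volume : Measure Space).toSphere.prod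
          (.volumeIoiPow (Module.finrank ℝ Space - 1))) := by
      have := (volume : Measure Space).measurePreserving_homeomorphUnitSphereProd.lintegral_comp_emb
        (Homeomorph.measurableEmbedding _) (f ∘ Subtype.val ∘ Prod.snd)
      simpa using this
    _ = sphereArea * ∫⁻ x : Ioi (0 : ℝ), f x
          ∂(.volumeIoiPow (Module.finrank ℝ Space - 1)) := by
      rw [lintegral_prod _ (by fun_prop)]
      simp [sphereArea, mul_comm]
    _ = _ := by
      rw [hd, Measure.volumeIoiPow, lintegral_withDensity_eq_lintegral_mul _ (by fun_prop)
        (by fun_prop), ← lintegral_subtype_comap measurableSet_Ioi]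
      rfl

/-- The weight `r²` on `(0, R)`. -/
noncomputable def radialMeasure (R : ℝ) : Measure ℝ :=
  (volume.restrict (Ioo 0 R)).withDensity fun r => ENNReal.ofReal (r ^ 2)

/-- All norms and integrals of radial functions reduce to dimension one through this pushforward. -/
lemma map_norm_restrict_droplet (R : ℝ) :
    (volume.restrict (droplet R)).map (fun x => ‖x‖) = sphereArea • radialMeasure R := by
  ext s hs
  rw [Measure.map_apply measurable_norm hs, Measure.smul_apply, radialMeasure,
    withDensity_apply _ hs, ← lintegral_indicator_one (measurable_norm hs),
    ← lintegral_indicator (s := droplet R) Metric.isOpen_ball.measurableSet]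
  have e : ∀ x : Space, (droplet R).indicator
      (((fun x : Space => ‖x‖) ⁻¹' s).indicator 1) x
        = ((Iio R ∩ s).indicator 1 : ℝ → ℝ≥0∞) ‖x‖ := fun x => by
    by_cases h1 : ‖x‖ < R <;> by_cases h2 : ‖x‖ ∈ s <;> simp [droplet, indicator, h1, h2]
  rw [lintegral_congr e,
    lintegral_fun_norm (measurable_one.indicator (measurableSet_Iio.inter hs)),
    ← lintegral_indicator hs, ← lintegral_indicator measurableSet_Ioo,
    ← lintegral_indicator measurableSet_Ioi, smul_eq_mul]
  congr 2
  ext y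
  by_cases h1 : 0 < y <;> by_cases h2 : y < R <;> by_cases h3 : y ∈ s <;>
    simp [indicator, h1, h2, h3]

lemma radialMeasure_absolutelyContinuous (R : ℝ) :
    radialMeasure R ≪ volume.restrict (Ioo 0 R) := withDensity_absolutelyContinuous _ _

lemma map_norm_absolutelyContinuous (R : ℝ) :
    (volume.restrict (droplet R)).map (fun x => ‖x‖) ≪ volume.restrict (Ioo 0 R) := by
  rw [map_norm_restrict_droplet]
  exact (Measure.smul_absolutelyContinuous).trans (radialMeasure_absolutelyContinuous R)

lemma quasiMeasurePreserving_norm (R : ℝ) : Measure.QuasiMeasurePreserving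
    (fun x : Space => ‖x‖) (volume.restrict (droplet R)) (volume.restrict (Ioo 0 R)) :=
  ⟨measurable_norm, map_norm_absolutelyContinuous R⟩

lemma eLpNorm_comp_norm {R : ℝ} {F : ℝ → ℝ}
    (hF : AEStronglyMeasurable F (volume.restrict (Ioo 0 R))) :
    eLpNorm (fun x : Space => F ‖x‖) 2 (volume.restrict (droplet R))
      = sphereArea ^ (1 / 2 : ℝ) * eLpNorm (fun r => r * F r) 2 (volume.restrict (Ioo 0 R)) := by
  have h1 := eLpNorm_map_measure (p := 2) (hF.mono_ac (map_norm_absolutelyContinuous R))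
    measurable_norm.aemeasurable
  rw [show (fun x : Space => F ‖x‖) = F ∘ fun x => ‖x‖ from rfl, ← h1,
    map_norm_restrict_droplet, eLpNorm_smul_measure_of_ne_zero sphereArea_pos.ne', smul_eq_mul]
  congr 1
  · norm_num
  rw [eLpNorm_eq_lintegral_rpow_enorm_toReal (by simp) (by simp),
    eLpNorm_eq_lintegral_rpow_enorm_toReal (by simp) (by simp), radialMeasure,
    lintegral_withDensity_eq_lintegral_mul₀ (by fun_prop) (by fun_prop)]
  congr 2
  ext r
  simp only [Pi.mul_apply, enorm_mul, ENNReal.toReal_ofNat, ENNReal.rpow_ofNat, mul_pow]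
  congr 1
  rw [← sq_abs r, ENNReal.ofReal_pow (abs_nonneg r), Real.enorm_eq_ofReal_abs]

lemma integral_comp_norm {R : ℝ} {F : ℝ → ℝ}
    (hF : AEStronglyMeasurable F (volume.restrict (Ioo 0 R))) :
    ∫ x in droplet R, F ‖x‖ = sphereArea.toReal * ∫ r in Ioo 0 R, r ^ 2 * F r := by
  rw [← integral_map measurable_norm.aemeasurable (hF.mono_ac (map_norm_absolutelyContinuous R)),
    map_norm_restrict_droplet, integral_smul_measure, radialMeasure,
    integral_withDensity_eq_integral_toReal_smul (by fun_prop) (by simp)]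
  simp [ENNReal.toReal_ofReal, sq_nonneg]

lemma integrable_comp_norm {R : ℝ} {F : ℝ → ℝ} :
    IntegrableOn (fun x : Space => F ‖x‖) (droplet R) ↔
      IntegrableOn (fun r => r ^ 2 * F r) (Ioo 0 R) := by
  simpa [droplet] using! integrableOn_fun_norm_addHaar (volume : Measure Space) (f := F) (r := R)

/-! ### Approximation of radial profiles by test profiles. -/

lemma exists_abs_deriv_smoothTransition_le :
    ∃ D : ℝ, 0 ≤ D ∧ ∀ x, |deriv Real.smoothTransition x| ≤ D := by
  have hc : Continuous (deriv Real.smoothTransition) :=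
    Real.smoothTransition.contDiff.continuous_deriv (n := 1) le_rfl
  obtain ⟨D, hD⟩ := isCompact_Icc.exists_bound_of_continuousOn
    (s := Icc (0 : ℝ) 1) hc.continuousOn
  refine ⟨D, (abs_nonneg _).trans (hD 0 (by simp)), fun x => ?_⟩
  have h0 := (abs_nonneg _).trans (hD 0 (by simp))
  rcases lt_or_ge x 0 with h | h
  · have : Real.smoothTransition =ᶠ[nhds x] fun _ => (0 : ℝ) := by
      filter_upwards [Iio_mem_nhds h] with y hy using
        Real.smoothTransition.zero_of_nonpos (le_of_lt hy)
    simpa [this.deriv_eq] using h0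
  rcases le_or_gt x 1 with h' | h'
  · exact hD x ⟨h, h'⟩
  · have : Real.smoothTransition =ᶠ[nhds x] fun _ => (1 : ℝ) := by
      filter_upwards [Ioi_mem_nhds h'] with y hy using
        Real.smoothTransition.one_of_one_le (le_of_lt hy)
    simpa [this.deriv_eq] using h0

lemma deriv_smoothTransition_of_one_lt {x : ℝ} (h : 1 < x) :
    deriv Real.smoothTransition x = 0 := by
  have : Real.smoothTransition =ᶠ[nhds x] fun _ => (1 : ℝ) := by
    filter_upwards [Ioi_mem_nhds h] with y hy using
      Real.smoothTransition.one_of_one_le (le_of_lt hy)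
  simp [this.deriv_eq]

/-- The cutoff vanishing near `0` and near `R`, with transitions on the scale `δ`. -/
noncomputable def annularCutoff (R δ r : ℝ) : ℝ :=
  Real.smoothTransition (r / δ - 1) * Real.smoothTransition ((R - r) / δ - 1)

lemma contDiff_annularCutoff (R δ : ℝ) : ContDiff ℝ ∞ (annularCutoff R δ) :=
  (Real.smoothTransition.contDiff.comp (by fun_prop)).mul
    (Real.smoothTransition.contDiff.comp (by fun_prop))

lemma hasDerivAt_annularCutoff (R δ r : ℝ) : HasDerivAt (annularCutoff R δ)
    (deriv Real.smoothTransition (r / δ - 1) / δ * Real.smoothTransition ((R - r) / δ - 1)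
      - Real.smoothTransition (r / δ - 1) *
        (deriv Real.smoothTransition ((R - r) / δ - 1) / δ)) r := by
  have hS : ∀ y, HasDerivAt Real.smoothTransition (deriv Real.smoothTransition y) y := fun y =>
    ((Real.smoothTransition.contDiff (n := 1)).differentiable (by simp) y).hasDerivAt
  have h1 : HasDerivAt (fun r : ℝ => r / δ - 1) (1 / δ) r :=
    ((hasDerivAt_id r).div_const δ).sub_const 1
  have h2 : HasDerivAt (fun r : ℝ => (R - r) / δ - 1) (-1 / δ) r :=
    (((hasDerivAt_id r).const_sub R).div_const δ).sub_const 1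
  exact (((hS _).comp r h1).mul ((hS _).comp r h2)).congr_deriv (by
    simp only [Function.comp_apply]; ring)

lemma annularCutoff_mem_Icc (R δ r : ℝ) : annularCutoff R δ r ∈ Icc (0 : ℝ) 1 :=
  ⟨mul_nonneg (Real.smoothTransition.nonneg _) (Real.smoothTransition.nonneg _),
    mul_le_one₀ (Real.smoothTransition.le_one _) (Real.smoothTransition.nonneg _)
      (Real.smoothTransition.le_one _)⟩

lemma tsupport_annularCutoff_subset {R δ : ℝ} (hδ : 0 < δ) :
    tsupport (annularCutoff R δ) ⊆ Icc δ (R - δ) := by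
  refine closure_minimal (fun r hr => ?_) isClosed_Icc
  by_contra hc
  apply hr
  rw [mem_Icc, not_and_or, not_le, not_le] at hc
  rcases hc with h | h
  · have : r / δ - 1 ≤ 0 := by rw [sub_nonpos, div_le_one hδ]; exact h.le
    simp [annularCutoff, Real.smoothTransition.zero_of_nonpos this]
  · have : (R - r) / δ - 1 ≤ 0 := by rw [sub_nonpos, div_le_one hδ]; linarith
    simp [annularCutoff, Real.smoothTransition.zero_of_nonpos this]

lemma annularCutoff_eq_one {R δ r : ℝ} (hδ : 0 < δ) (h1 : 2 * δ < r) (h2 : r < R - 2 * δ) :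
    annularCutoff R δ r = 1 := by
  have a : 1 ≤ r / δ - 1 := by rw [le_sub_iff_add_le, le_div_iff₀ hδ]; linarith
  have b : 1 ≤ (R - r) / δ - 1 := by rw [le_sub_iff_add_le, le_div_iff₀ hδ]; linarith
  simp [annularCutoff, Real.smoothTransition.one_of_one_le a,
    Real.smoothTransition.one_of_one_le b]

lemma deriv_annularCutoff_eq_zero {R δ r : ℝ} (hδ : 0 < δ) (h1 : 2 * δ < r)
    (h2 : r < R - 2 * δ) : deriv (annularCutoff R δ) r = 0 := by
  have : annularCutoff R δ =ᶠ[nhds r] fun _ => (1 : ℝ) := by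
    filter_upwards [Ioo_mem_nhds h1 h2] with y hy using annularCutoff_eq_one hδ hy.1 hy.2
  simp [this.deriv_eq]

/-- A smooth function vanishing at `R` is approximated by its cutoffs near `0` and `R`. -/
lemma exists_cutoff_approx {R : ℝ} (hR : 0 < R) {g : ℝ → ℝ} (hg : ContDiff ℝ ∞ g) (hgR : g R = 0)
    {ε : ℝ≥0∞} (hε : 0 < ε) : ∃ γ : ℝ → ℝ, ContDiff ℝ ∞ γ ∧ tsupport γ ⊆ Ioo 0 R ∧
      eLpNorm (fun r => r * (deriv g r - deriv γ r)) 2 (volume.restrict (Ioo 0 R)) < ε ∧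
      eLpNorm (fun r => g r - γ r) 2 (volume.restrict (Ioo 0 R)) < ε := by
  obtain ⟨D, hD0, hD⟩ := exists_abs_deriv_smoothTransition_le
  obtain ⟨M₀, hM₀⟩ := isCompact_Icc.exists_bound_of_continuousOn
    (s := Icc (0 : ℝ) R) hg.continuous.continuousOn
  have hgd : Continuous (deriv g) := hg.continuous_deriv (by simp)
  obtain ⟨M₁, hM₁⟩ := isCompact_Icc.exists_bound_of_continuousOn
    (s := Icc (0 : ℝ) R) hgd.continuousOn
  have hM₀0 : 0 ≤ M₀ := (norm_nonneg _).trans (hM₀ 0 ⟨le_rfl, hR.le⟩)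
  have hM₁0 : 0 ≤ M₁ := (norm_nonneg _).trans (hM₁ 0 ⟨le_rfl, hR.le⟩)
  have hlip : ∀ r ∈ Icc (0 : ℝ) R, |g r| ≤ M₁ * (R - r) := fun r hr => by
    have := (convex_Icc (0 : ℝ) R).norm_image_sub_le_of_norm_deriv_le
      (f := g) (fun x _ => hg.differentiable (by simp) x) hM₁ ⟨hR.le, le_rfl⟩ hr
    simpa [hgR, abs_of_nonpos (sub_nonpos.2 hr.2)] using this
  -- The last three summands are the bounds `t1`, `t2`, `t3` below on the pieces of the weighted
  -- derivative error; `M₀` bounds the error of the values. Both errors are bounded by `K` on a set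
  -- of measure at most `4δ` and vanish elsewhere, so their norms tend to `0` with `δ`.
  set K : ℝ := M₀ + R * M₁ + 2 * D * M₀ + 2 * R * D * M₁ with hK
  have hK0 : 0 ≤ K := by positivity
  obtain ⟨e, he0, heε⟩ := ENNReal.lt_iff_exists_nnreal_btwn.1 hε
  have he : 0 < (e : ℝ) := by exact_mod_cast he0
  set η : ℝ := e / (2 * (K + 1)) with hη
  have hη0 : 0 < η := by positivity
  -- Squared so that the square root of the measure `4δ` is `2η`.
  set δ : ℝ := η ^ 2
  have hδ : 0 < δ := by positivity
  set E : Set ℝ := Icc 0 (2 * δ) ∪ Icc (R - 2 * δ) R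
  have hE : volume.restrict (Ioo 0 R) E ≤ ENNReal.ofReal (4 * δ) := by
    refine (Measure.restrict_apply_le _ _).trans ((measure_union_le _ _).trans ?_)
    rw [Real.volume_Icc, Real.volume_Icc, ← ENNReal.ofReal_add (by linarith) (by linarith)]
    apply ENNReal.ofReal_le_ofReal; linarith
  have small : ∀ f : ℝ → ℝ, (∀ r ∈ Ioo 0 R, |f r| ≤ E.indicator (fun _ => K) r) →
      eLpNorm f 2 (volume.restrict (Ioo 0 R)) < ε := fun f hf => by
    refine lt_of_le_of_lt ?_ heε
    calc eLpNorm f 2 (volume.restrict (Ioo 0 R))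
        ≤ eLpNorm (E.indicator fun _ => K) 2 (volume.restrict (Ioo 0 R)) :=
          eLpNorm_mono_ae_real ((ae_restrict_mem measurableSet_Ioo).mono hf)
      _ ≤ ‖K‖ₑ * (volume.restrict (Ioo 0 R) E) ^ (1 / (2 : ℝ≥0∞).toReal) :=
          eLpNorm_indicator_const_le _ _
      _ ≤ ENNReal.ofReal K * ENNReal.ofReal (4 * δ) ^ (1 / (2 : ℝ≥0∞).toReal) := by
          rw [Real.enorm_eq_ofReal hK0]; gcongr
      _ = ENNReal.ofReal (K * (2 * η)) := by
          rw [ENNReal.ofReal_rpow_of_nonneg (by positivity) (by simp), ENNReal.ofReal_mul hK0]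
          congr 2
          rw [show (4 : ℝ) * δ = (2 * η) ^ 2 by ring, ENNReal.toReal_ofNat,
            ← Real.sqrt_eq_rpow, Real.sqrt_sq (by positivity)]
      _ ≤ e := by
          rw [← ENNReal.ofReal_coe_nnreal]
          apply ENNReal.ofReal_le_ofReal
          rw [hη, show K * (2 * ((e : ℝ) / (2 * (K + 1)))) = e * (K / (K + 1)) by field_simp]
          exact mul_le_of_le_one_right he.le ((div_le_one (by linarith)).2 (by linarith))
  have hout : ∀ r ∈ Ioo 0 R, r ∉ E → 2 * δ < r ∧ r < R - 2 * δ := fun r hr h => by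
    simp only [E, mem_union, mem_Icc, not_or, not_and, not_le] at h
    exact ⟨h.1 hr.1.le, by by_contra hc; exact absurd (h.2 (not_lt.1 hc)) (not_lt.2 hr.2.le)⟩
  set χ := annularCutoff R δ
  have hχd : Differentiable ℝ χ := (contDiff_annularCutoff R δ).differentiable (by simp)
  refine ⟨χ * g, (contDiff_annularCutoff R δ).mul hg, ?_, small _ fun r hr => ?_,
    small _ fun r hr => ?_⟩
  · exact ((tsupport_mul_subset_left).trans (tsupport_annularCutoff_subset hδ)).trans
      fun r hr => ⟨hδ.trans_le hr.1, hr.2.trans_lt (by linarith)⟩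
  · have hr' : r ∈ Icc 0 R := ⟨hr.1.le, hr.2.le⟩
    have hd : deriv (χ * g) r = deriv χ r * g r + χ r * deriv g r :=
      deriv_mul (hχd r) (hg.differentiable (by simp) r)
    rw [hd]
    by_cases hrE : r ∈ E
    swap
    · obtain ⟨a, b⟩ := hout r hr hrE
      rw [deriv_annularCutoff_eq_zero hδ a b, show χ r = 1 from annularCutoff_eq_one hδ a b]
      simp [hrE]
    rw [indicator_of_mem hrE]
    have hχ := annularCutoff_mem_Icc R δ r
    have t1 : |r * ((1 - χ r) * deriv g r)| ≤ R * M₁ := by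
      rw [abs_mul, abs_mul, abs_of_pos hr.1, abs_of_nonneg (sub_nonneg.2 hχ.2)]
      have := mul_le_mul (sub_le_self 1 hχ.1) (hM₁ r hr') (norm_nonneg _) zero_le_one
      rw [one_mul] at this
      exact mul_le_mul hr.2.le this (mul_nonneg (sub_nonneg.2 hχ.2) (abs_nonneg _)) hR.le
    have t2 : |r * (deriv Real.smoothTransition (r / δ - 1) / δ *
        Real.smoothTransition ((R - r) / δ - 1)) * g r| ≤ 2 * D * M₀ := by
      -- Near the origin the weight `r ≤ 2δ` cancels the factor `1/δ` from the cutoff, so `g` need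
      -- not vanish at `0`: a point is negligible for `W^{1,2}` in dimension three.
      rcases lt_or_ge 1 (r / δ - 1) with h | h
      · rw [deriv_smoothTransition_of_one_lt h]; simp; positivity
      have h2 : r / δ ≤ 2 := by linarith
      rw [show r * (deriv Real.smoothTransition (r / δ - 1) / δ *
        Real.smoothTransition ((R - r) / δ - 1)) * g r = (r / δ) *
          deriv Real.smoothTransition (r / δ - 1) *
        Real.smoothTransition ((R - r) / δ - 1) * g r by ring, abs_mul, abs_mul, abs_mul,
        abs_of_nonneg (div_nonneg hr.1.le hδ.le), abs_of_nonneg (Real.smoothTransition.nonneg _)]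
      have a1 := mul_le_mul h2 (hD (r / δ - 1)) (abs_nonneg _) zero_le_two
      have a2 := mul_le_mul a1 (Real.smoothTransition.le_one ((R - r) / δ - 1))
        (Real.smoothTransition.nonneg _) (by positivity)
      rw [mul_one] at a2
      exact mul_le_mul a2 (hM₀ r hr') (abs_nonneg _) (by positivity)
    have t3 : |r * (Real.smoothTransition (r / δ - 1) *
        (deriv Real.smoothTransition ((R - r) / δ - 1) / δ)) * g r| ≤ 2 * R * D * M₁ := by
      rcases lt_or_ge 1 ((R - r) / δ - 1) with h | h
      · rw [deriv_smoothTransition_of_one_lt h]; simp; positivity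
      have h2 : (R - r) / δ ≤ 2 := by linarith
      -- Near `R` there is no small weight; the factor `1/δ` is absorbed by the linear vanishing of
      -- `g` at `R`.
      have h3 : |g r / δ| ≤ 2 * M₁ := by
        rw [abs_div, abs_of_pos hδ, div_le_iff₀ hδ]
        rw [div_le_iff₀ hδ] at h2
        nlinarith [hlip r hr']
      rw [show r * (Real.smoothTransition (r / δ - 1) *
        (deriv Real.smoothTransition ((R - r) / δ - 1) / δ)) * g r =
          r * Real.smoothTransition (r / δ - 1) *
          deriv Real.smoothTransition ((R - r) / δ - 1) * (g r / δ) by ring,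
        abs_mul, abs_mul, abs_mul, abs_of_pos hr.1,
        abs_of_nonneg (Real.smoothTransition.nonneg _)]
      have a1 := mul_le_mul hr.2.le (Real.smoothTransition.le_one (r / δ - 1))
        (Real.smoothTransition.nonneg _) hR.le
      have a2 := mul_le_mul a1 (hD ((R - r) / δ - 1)) (abs_nonneg _) (by positivity)
      have a3 := mul_le_mul a2 h3 (abs_nonneg _) (by positivity)
      linarith
    rw [(hasDerivAt_annularCutoff R δ r).deriv, show ∀ a b : ℝ, r * (deriv g r -
      ((a - b) * g r + χ r * deriv g r)) = r * ((1 - χ r) * deriv g r) - r * a * g r + r * b * g r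
      by intros; ring]
    refine (abs_add_le _ _).trans ?_
    have := abs_sub (r * ((1 - χ r) * deriv g r))
      (r * (deriv Real.smoothTransition (r / δ - 1) / δ *
        Real.smoothTransition ((R - r) / δ - 1)) * g r)
    linarith
  · by_cases hrE : r ∈ E
    swap
    · obtain ⟨a, b⟩ := hout r hr hrE
      simp [hrE, show χ r = 1 from annularCutoff_eq_one hδ a b]
    rw [indicator_of_mem hrE, Pi.mul_apply]
    have hχ := annularCutoff_mem_Icc R δ r
    have : |g r - χ r * g r| ≤ M₀ := by
      rw [show g r - χ r * g r = (1 - χ r) * g r by ring, abs_mul,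
        abs_of_nonneg (sub_nonneg.2 hχ.2)]
      have := mul_le_mul (sub_le_self 1 hχ.1) (hM₀ r ⟨hr.1.le, hr.2.le⟩) (norm_nonneg _) zero_le_one
      rwa [one_mul] at this
    have : 0 ≤ R * M₁ + 2 * D * M₀ + 2 * R * D * M₁ := by positivity
    linarith

/-- An absolutely continuous function with square-integrable derivative vanishing at `R` is
approximated by a smooth one in the `W^{1,2}` norm. -/
lemma exists_smooth_approx {R : ℝ} (hR : 0 < R) {g : ℝ → ℝ}
    (hg : AbsolutelyContinuousOnInterval g 0 R)
    (hg' : MemLp (deriv g) 2 (volume.restrict (Ioo 0 R))) (hgR : g R = 0)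
    {ε : ℝ≥0∞} (hε : 0 < ε) : ∃ γ : ℝ → ℝ, ContDiff ℝ ∞ γ ∧ γ R = 0 ∧
      eLpNorm (fun r => r * (deriv g r - deriv γ r)) 2 (volume.restrict (Ioo 0 R)) < ε ∧
      eLpNorm (fun r => g r - γ r) 2 (volume.restrict (Ioo 0 R)) < ε := by
  set μ := volume.restrict (Ioo 0 R)
  obtain ⟨e, he0, heε⟩ := ENNReal.lt_iff_exists_nnreal_btwn.1 hε
  have he : 0 < (e : ℝ) := by exact_mod_cast he0
  -- The same `d` serves both estimates: the weight costs a factor `R` in the first, while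
  -- integration from `R` costs `√R` in sup norm and another `√R` in passing to `L²`.
  set d : ℝ := e / R
  have hd : 0 < d := by positivity
  have hRd : ENNReal.ofReal R * ENNReal.ofReal d = e := by
    rw [← ENNReal.ofReal_mul hR.le, show R * d = e by simp only [d]; field_simp,
      ENNReal.ofReal_coe_nnreal]
  obtain ⟨ψ, -, hψ, hψd⟩ := hg'.exist_eLpNorm_sub_le (by simp) (by simp) hd
  have hder : ∀ r, HasDerivAt (fun r => ∫ s in R..r, ψ s) (ψ r) r := fun r =>
    (hψ.continuous.integral_hasStrictDerivAt R r).hasDerivAt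
  have hder' : deriv (fun r => ∫ s in R..r, ψ s) = ψ := funext fun r => (hder r).deriv
  refine ⟨fun r => ∫ s in R..r, ψ s, ?_, by simp, ?_, ?_⟩
  · rw [contDiff_infty_iff_deriv, hder']
    exact ⟨fun r => (hder r).differentiableAt, hψ⟩
  · rw [hder']
    refine lt_of_le_of_lt ?_ heε
    rw [← hRd]
    refine (eLpNorm_le_mul_eLpNorm_of_ae_le_mul (g := deriv g - ψ) (c := R)
      ((ae_restrict_mem measurableSet_Ioo).mono fun r hr => ?_) 2).trans
      (mul_le_mul_right hψd _)
    rw [norm_mul, Real.norm_of_nonneg hr.1.le]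
    exact mul_le_mul_of_nonneg_right hr.2.le (norm_nonneg _)
  · have hpt : ∀ r ∈ Ioo 0 R, ‖g r - ∫ s in R..r, ψ s‖ₑ ≤ eLpNorm (deriv g - ψ) 1 μ := by
      intro r hr
      have i1 : IntervalIntegrable (deriv g) volume R r :=
        (hg.mono (by rw [uIcc_of_ge hr.2.le, uIcc_of_le hR.le]
                     exact Icc_subset_Icc_left hr.1.le)).intervalIntegrable_deriv
      have i2 : g r = ∫ s in R..r, deriv g s := by
        rw [AbsolutelyContinuousOnInterval.integral_deriv_eq_sub, hgR, sub_zero]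
        exact hg.mono (by rw [uIcc_of_ge hr.2.le, uIcc_of_le hR.le]
                          exact Icc_subset_Icc_left hr.1.le)
      rw [i2, ← intervalIntegral.integral_sub i1 (hψ.continuous.intervalIntegrable _ _),
        intervalIntegral.integral_symm, enorm_neg, intervalIntegral.integral_of_le hr.2.le,
        integral_Ioc_eq_integral_Ioo]
      refine (enorm_integral_le_lintegral_enorm _).trans ?_
      rw [eLpNorm_one_eq_lintegral_enorm]
      exact lintegral_mono_set (Ioo_subset_Ioo_left hr.1.le)
    have hμ : μ univ = ENNReal.ofReal R := by simp [μ]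
    have h12 : eLpNorm (deriv g - ψ) 1 μ ≤ ENNReal.ofReal d * ENNReal.ofReal R ^ (1 / 2 : ℝ) := by
      refine (eLpNorm_le_eLpNorm_mul_rpow_measure_univ (p := 1) (q := 2) (by simp)
        (hg'.1.sub hψ.continuous.aestronglyMeasurable)).trans ?_
      rw [hμ]
      norm_num
      gcongr
    refine lt_of_le_of_lt ?_ heε
    refine (eLpNorm_le_of_ae_enorm_bound ((ae_restrict_mem measurableSet_Ioo).mono hpt)).trans ?_
    rw [hμ, ← hRd, smul_eq_mul]
    calc _ ≤ ENNReal.ofReal d * ENNReal.ofReal R ^ (1 / 2 : ℝ) *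
          ENNReal.ofReal R ^ (2 : ℝ≥0∞).toReal⁻¹ := by gcongr
      _ = ENNReal.ofReal R * ENNReal.ofReal d := by
        rw [mul_assoc, ENNReal.toReal_ofNat, ← ENNReal.rpow_add_of_nonneg _ _ (by norm_num)
          (by norm_num), mul_comm]
        norm_num

lemma exists_test_approx {R : ℝ} (hR : 0 < R) {g : ℝ → ℝ}
    (hg : AbsolutelyContinuousOnInterval g 0 R)
    (hg' : MemLp (deriv g) 2 (volume.restrict (Ioo 0 R))) (hgR : g R = 0)
    {ε : ℝ≥0∞} (hε : 0 < ε) : ∃ γ : ℝ → ℝ, ContDiff ℝ ∞ γ ∧ tsupport γ ⊆ Ioo 0 R ∧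
      eLpNorm (fun r => r * (deriv g r - deriv γ r)) 2 (volume.restrict (Ioo 0 R)) < ε ∧
      eLpNorm (fun r => g r - γ r) 2 (volume.restrict (Ioo 0 R)) < ε := by
  obtain ⟨γ₀, hs, hγ₀R, h1, h2⟩ := exists_smooth_approx hR hg hg' hgR (ENNReal.half_pos hε.ne')
  obtain ⟨γ, hγ, ht, h1', h2'⟩ := exists_cutoff_approx hR hs hγ₀R (ENNReal.half_pos hε.ne')
  have c0 : Continuous (deriv γ₀) := hs.continuous_deriv (by simp)
  have c1 : Continuous (deriv γ) := hγ.continuous_deriv (by simp)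
  have hgm : AEStronglyMeasurable g (volume.restrict (Ioo 0 R)) :=
    (hg.continuousOn.mono
      (by rw [uIcc_of_le hR.le]; exact Ioo_subset_Icc_self)).aestronglyMeasurable
      measurableSet_Ioo
  refine ⟨γ, hγ, ht, ?_, ?_⟩
  · rw [show (fun r => r * (deriv g r - deriv γ r)) = (fun r => r * (deriv g r - deriv γ₀ r)) +
        fun r => r * (deriv γ₀ r - deriv γ r) by ext r; simp only [Pi.add_apply]; ring,
      ← ENNReal.add_halves ε]
    exact (eLpNorm_add_le (continuous_id.aestronglyMeasurable.mul
      (hg'.1.sub c0.aestronglyMeasurable)) (by fun_prop) (by simp)).trans_lt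
      (ENNReal.add_lt_add h1 h1')
  · rw [show (fun r => g r - γ r) = (fun r => g r - γ₀ r) + fun r => γ₀ r - γ r by
      ext r; simp, ← ENNReal.add_halves ε]
    exact (eLpNorm_add_le (hgm.sub hs.continuous.aestronglyMeasurable)
      (hs.continuous.sub hγ.continuous).aestronglyMeasurable (by simp)).trans_lt
      (ENNReal.add_lt_add h2 h2')

/-! ### Products of a radial profile with an angular function. -/

/-- `A` is smooth off the origin, bounded by `C`, with gradient bounded by `C / |x|`. -/
structure IsAngular (A : Space → ℝ) (C : ℝ) : Prop where
  contDiffAt : ∀ x, x ≠ 0 → ContDiffAt ℝ ∞ A x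
  abs_le : ∀ x, |A x| ≤ C
  abs_partialDeriv_le : ∀ k x, x ≠ 0 → |partialDeriv k A x| ≤ C / ‖x‖

/-- The classical partial derivative of `g(|x|) A(x)` off the origin. -/
noncomputable def radialPartial (g : ℝ → ℝ) (A : Space → ℝ) (k : Fin 3) (x : Space) : ℝ :=
  deriv g ‖x‖ * (x k / ‖x‖) * A x + g ‖x‖ * partialDeriv k A x

lemma abs_apply_div_norm_le (x : Space) (k : Fin 3) : |x k / ‖x‖| ≤ 1 := by
  rw [abs_div, abs_norm]
  exact div_le_one_of_le₀ (PiLp.norm_apply_le x k) (norm_nonneg _)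

lemma hasFDerivAt_norm_space {x : Space} (hx : x ≠ 0) :
    HasFDerivAt (fun y : Space => ‖y‖) (‖x‖⁻¹ • innerSL ℝ x) x := by
  have h := (hasStrictFDerivAt_norm_sq x).hasFDerivAt.sqrt (by simpa using hx)
  simp only [Real.sqrt_sq (norm_nonneg _)] at h
  refine h.congr_fderiv (ContinuousLinearMap.ext fun y => ?_)
  simp only [smul_apply, smul_eq_mul, nsmul_eq_mul, Nat.cast_ofNat]
  field_simp

lemma hasFDerivAt_radial_mul {γ : ℝ → ℝ} {A : Space → ℝ} {x : Space} (hx : x ≠ 0)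
    (hγ : DifferentiableAt ℝ γ ‖x‖) (hA : DifferentiableAt ℝ A x) (k : Fin 3) :
    partialDeriv k (fun y => γ ‖y‖ * A y) x = radialPartial γ A k x := by
  have h1 : HasFDerivAt (fun y : Space => γ ‖y‖) (deriv γ ‖x‖ • (‖x‖⁻¹ • innerSL ℝ x)) x :=
    hγ.hasDerivAt.comp_hasFDerivAt x (hasFDerivAt_norm_space hx)
  have h2 := h1.mul hA.hasFDerivAt
  simp only [partialDeriv, radialPartial]
  rw [show (fun y : Space => γ ‖y‖ * A y) = (fun y : Space => γ ‖y‖) * A from rfl, h2.fderiv]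
  simp [EuclideanSpace.inner_single_right]
  ring

lemma ae_ne_zero_droplet (R : ℝ) : ∀ᵐ x ∂volume.restrict (droplet R), x ≠ (0 : Space) :=
  ae_restrict_of_ae (by simp [ae_iff, measure_singleton])

lemma IsAngular.aestronglyMeasurable {A : Space → ℝ} {C : ℝ} (hA : IsAngular A C) :
    AEStronglyMeasurable A volume := by
  have : ContinuousOn A {0}ᶜ := fun x hx => (hA.contDiffAt x hx).continuousAt.continuousWithinAt
  have h := this.aestronglyMeasurable (μ := volume) (measurableSet_singleton (0 : Space)).compl
  rwa [restrict_compl_singleton] at h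

lemma measurable_partialDeriv (k : Fin 3) (A : Space → ℝ) : Measurable (partialDeriv k A) :=
  measurable_fderiv_apply_const ℝ A _

lemma aestronglyMeasurable_comp_norm {R : ℝ} {F : ℝ → ℝ}
    (hF : AEStronglyMeasurable F (volume.restrict (Ioo 0 R))) :
    AEStronglyMeasurable (fun x : Space => F ‖x‖) (volume.restrict (droplet R)) :=
  hF.comp_quasiMeasurePreserving (quasiMeasurePreserving_norm R)

lemma aestronglyMeasurable_radialPartial {R : ℝ} {g : ℝ → ℝ} {A : Space → ℝ} {C : ℝ}
    (hg : AEStronglyMeasurable g (volume.restrict (Ioo 0 R))) (hA : IsAngular A C) (k : Fin 3) :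
    AEStronglyMeasurable (radialPartial g A k) (volume.restrict (droplet R)) := by
  have m1 := aestronglyMeasurable_comp_norm (R := R) (measurable_deriv g).aestronglyMeasurable
  have m2 := aestronglyMeasurable_comp_norm hg
  have m3 : AEStronglyMeasurable (fun x : Space => x k / ‖x‖) (volume.restrict (droplet R)) :=
    Measurable.aestronglyMeasurable (by fun_prop)
  exact ((m1.mul m3).mul hA.aestronglyMeasurable.restrict).add
    (m2.mul (measurable_partialDeriv k A).aestronglyMeasurable)

/-- The measure `r² dr` cancels a singularity of order `1/|x|`, so the part coming from the gradient
of `A` is controlled by the unweighted norm of the profile. -/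
lemma eLpNorm_le_of_abs_le_radial {R C : ℝ} {u : Space → ℝ} {F₁ F₂ : ℝ → ℝ}
    (h₁ : AEStronglyMeasurable F₁ (volume.restrict (Ioo 0 R)))
    (h₂ : AEStronglyMeasurable F₂ (volume.restrict (Ioo 0 R)))
    (hu : ∀ x, x ≠ 0 → |u x| ≤ C * (|F₁ ‖x‖| + |F₂ ‖x‖| / ‖x‖)) :
    eLpNorm u 2 (volume.restrict (droplet R)) ≤ ENNReal.ofReal C * sphereArea ^ (1 / 2 : ℝ) *
      (eLpNorm (fun r => r * F₁ r) 2 (volume.restrict (Ioo 0 R)) +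
        eLpNorm F₂ 2 (volume.restrict (Ioo 0 R))) := by
  have h₂' : AEStronglyMeasurable (fun r => |F₂ r| / r) (volume.restrict (Ioo 0 R)) :=
    (h₂.norm.aemeasurable.div aemeasurable_id).aestronglyMeasurable
  have m1 := aestronglyMeasurable_comp_norm h₁.norm
  have m2 := aestronglyMeasurable_comp_norm h₂'
  refine (eLpNorm_le_mul_eLpNorm_of_ae_le_mul (g := (fun x : Space => ‖F₁ ‖x‖‖) +
    fun x : Space => |F₂ ‖x‖| / ‖x‖) (c := C) ?_ 2).trans ?_
  · filter_upwards [ae_ne_zero_droplet R] with x hx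
    refine (hu x hx).trans (le_of_eq ?_)
    rw [Pi.add_apply, Real.norm_of_nonneg (by positivity), Real.norm_eq_abs]
  rw [mul_assoc]
  refine mul_le_mul_right ((eLpNorm_add_le m1 m2 (by simp)).trans (le_of_eq ?_)) _
  rw [mul_add, eLpNorm_comp_norm h₁.norm, eLpNorm_comp_norm h₂']
  congr 2
  · refine eLpNorm_congr_norm_ae (.of_forall fun r => ?_)
    simp
  · refine eLpNorm_congr_norm_ae ((ae_restrict_mem measurableSet_Ioo).mono fun r hr => ?_)
    rw [mul_div_cancel₀ _ hr.1.ne']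
    simp

/-- The `W^{1,2}` profiles. -/
def IsProfile (R : ℝ) (g : ℝ → ℝ) : Prop :=
  AbsolutelyContinuousOnInterval g 0 R ∧ MemLp (deriv g) 2 (volume.restrict (Ioo 0 R))

lemma IsProfile.continuousOn {R : ℝ} (hR : 0 < R) {g : ℝ → ℝ} (hg : IsProfile R g) :
    ContinuousOn g (Icc 0 R) := by
  have := hg.1.continuousOn
  rwa [uIcc_of_le hR.le] at this

lemma IsProfile.aestronglyMeasurable {R : ℝ} (hR : 0 < R) {g : ℝ → ℝ} (hg : IsProfile R g) :
    AEStronglyMeasurable g (volume.restrict (Ioo 0 R)) :=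
  ((hg.continuousOn hR).mono Ioo_subset_Icc_self).aestronglyMeasurable measurableSet_Ioo

lemma IsProfile.memLp {R : ℝ} (hR : 0 < R) {g : ℝ → ℝ} (hg : IsProfile R g) (p : ℝ≥0∞) :
    MemLp g p (volume.restrict (Ioo 0 R)) := by
  obtain ⟨C, hC⟩ := isCompact_Icc.exists_bound_of_continuousOn (hg.continuousOn hR)
  exact MemLp.of_bound (hg.aestronglyMeasurable hR) C
    ((ae_restrict_mem measurableSet_Ioo).mono fun r hr => hC r ⟨hr.1.le, hr.2.le⟩)

lemma memLp_id_mul {R : ℝ} {g : ℝ → ℝ} (hg : MemLp g 2 (volume.restrict (Ioo 0 R))) :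
    MemLp (fun r => r * g r) 2 (volume.restrict (Ioo 0 R)) := by
  refine hg.of_le_mul (c := R) (continuous_id.aestronglyMeasurable.mul hg.1) ?_
  filter_upwards [ae_restrict_mem measurableSet_Ioo] with r hr
  rw [norm_mul, Real.norm_of_nonneg hr.1.le]
  exact mul_le_mul_of_nonneg_right hr.2.le (norm_nonneg _)

lemma IsAngular.abs_radialPartial_le {A : Space → ℝ} {C : ℝ} (hA : IsAngular A C)
    (a b : ℝ) (k : Fin 3) {x : Space} (hx : x ≠ 0) :
    |a * (x k / ‖x‖) * A x + b * partialDeriv k A x| ≤ C * (|a| + |b| / ‖x‖) := by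
  refine (abs_add_le _ _).trans ?_
  rw [abs_mul, abs_mul, abs_mul, mul_add]
  refine add_le_add ?_ ?_
  · have := mul_le_mul (abs_apply_div_norm_le x k) (hA.abs_le x) (abs_nonneg _) zero_le_one
    calc _ = |a| * (|x k / ‖x‖| * |A x|) := by ring
      _ ≤ |a| * (1 * C) := by gcongr
      _ = C * |a| := by ring
  · calc _ ≤ |b| * (C / ‖x‖) :=
        mul_le_mul_of_nonneg_left (hA.abs_partialDeriv_le k x hx) (abs_nonneg _)
      _ = _ := by ring

lemma memLp_radial_mul {R : ℝ} (hR : 0 < R) {g : ℝ → ℝ} (hg : IsProfile R g) {A : Space → ℝ}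
    {C : ℝ} (hA : IsAngular A C) :
    MemLp (fun x => g ‖x‖ * A x) 2 (volume.restrict (droplet R)) := by
  refine ⟨(aestronglyMeasurable_comp_norm (hg.aestronglyMeasurable hR)).mul
    hA.aestronglyMeasurable.restrict, ?_⟩
  refine (eLpNorm_le_of_abs_le_radial (C := C) (F₁ := g) (F₂ := 0) (hg.aestronglyMeasurable hR)
    aestronglyMeasurable_zero fun x _ => ?_).trans_lt ?_
  · rw [abs_mul, mul_comm]
    simpa using mul_le_mul_of_nonneg_right (hA.abs_le x) (abs_nonneg _)
  · have := sphereArea_ne_top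
    exact ENNReal.mul_lt_top (ENNReal.mul_lt_top (by simp)
      (ENNReal.rpow_lt_top_of_nonneg (by norm_num) this))
      (ENNReal.add_lt_top.2 ⟨(memLp_id_mul (hg.memLp hR 2)).2, by simp⟩)

lemma memLp_radialPartial {R : ℝ} (hR : 0 < R) {g : ℝ → ℝ} (hg : IsProfile R g) {A : Space → ℝ}
    {C : ℝ} (hA : IsAngular A C) (k : Fin 3) :
    MemLp (radialPartial g A k) 2 (volume.restrict (droplet R)) := by
  refine ⟨aestronglyMeasurable_radialPartial (hg.aestronglyMeasurable hR) hA k, ?_⟩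
  refine (eLpNorm_le_of_abs_le_radial (C := C) (F₁ := deriv g) (F₂ := g) hg.2.1
    (hg.aestronglyMeasurable hR) fun x hx => hA.abs_radialPartial_le _ _ k hx).trans_lt ?_
  have := sphereArea_ne_top
  exact ENNReal.mul_lt_top (ENNReal.mul_lt_top (by simp)
    (ENNReal.rpow_lt_top_of_nonneg (by norm_num) this))
    (ENNReal.add_lt_top.2 ⟨(memLp_id_mul hg.2).2, (hg.memLp hR 2).2⟩)

lemma isTest_radial_mul {R : ℝ} {γ : ℝ → ℝ} (hγ : ContDiff ℝ ∞ γ) (ht : tsupport γ ⊆ Ioo 0 R)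
    {A : Space → ℝ} {C : ℝ} (hA : IsAngular A C) :
    IsTest (droplet R) fun x => γ ‖x‖ * A x := by
  have hsub : tsupport (fun x : Space => γ ‖x‖ * A x) ⊆ (fun x : Space => ‖x‖) ⁻¹' tsupport γ := by
    refine closure_minimal (fun x hx => ?_) ((isClosed_tsupport γ).preimage continuous_norm)
    exact subset_tsupport γ (left_ne_zero_of_mul hx)
  have hsub' : tsupport (fun x : Space => γ ‖x‖ * A x) ⊆ droplet R := fun x hx => by
    simpa [droplet] using (ht (hsub hx)).2
  refine ⟨contDiff_iff_contDiffAt.2 fun x => ?_, ?_, hsub'⟩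
  · rcases eq_or_ne x 0 with rfl | hx
    · have h0 : (0 : Space) ∉ tsupport fun x : Space => γ ‖x‖ * A x := fun h => by
        simpa using (ht (hsub h)).1
      exact contDiffAt_const.congr_of_eventuallyEq (notMem_tsupport_iff_eventuallyEq.1 h0)
    · exact (hγ.contDiffAt.comp x (contDiffAt_norm ℝ hx)).mul (hA.contDiffAt x hx)
  · exact HasCompactSupport.of_support_subset_isCompact (isCompact_closedBall (0 : Space) R)
      ((subset_tsupport _).trans (hsub'.trans Metric.ball_subset_closedBall))

lemma isTestLimit_radial_mul {R : ℝ} (hR : 0 < R) {g : ℝ → ℝ} (hg : IsProfile R g)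
    (hgR : g R = 0) {A : Space → ℝ} {C : ℝ} (hA : IsAngular A C) :
    IsTestLimit (droplet R) (fun x => g ‖x‖ * A x) (radialPartial g A) := by
  refine ⟨memLp_radial_mul hR hg hA, memLp_radialPartial hR hg hA, fun ε hε => ?_⟩
  -- The `2` pays for the two norms in the derivative estimate, the `R` for the weight in the
  -- estimate of the values.
  set K : ℝ≥0∞ := ENNReal.ofReal C * sphereArea ^ (1 / 2 : ℝ) * (2 + ENNReal.ofReal R) with hK
  have hKt : K ≠ ⊤ := ENNReal.mul_ne_top (ENNReal.mul_ne_top (by simp)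
    (ENNReal.rpow_lt_top_of_nonneg (by norm_num) sphereArea_ne_top).ne) (by simp)
  obtain ⟨e, he, heK⟩ : ∃ e : ℝ≥0∞, 0 < e ∧ K * e < ε := by
    obtain ⟨e, he0, heε⟩ := ENNReal.lt_iff_exists_nnreal_btwn.1 hε
    have hK1 : K + 1 ≠ ⊤ := by simpa using hKt
    refine ⟨e / (K + 1), ENNReal.div_pos he0.ne' hK1, lt_of_le_of_lt ?_ heε⟩
    calc K * (e / (K + 1)) ≤ (K + 1) * (e / (K + 1)) := mul_le_mul_left le_self_add _
      _ = e := ENNReal.mul_div_cancel (by simp) hK1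
  obtain ⟨γ, hγ, ht, h1, h2⟩ := exists_test_approx hR hg.1 hg.2 hgR he
  have hgm := hg.aestronglyMeasurable hR
  have hγm : AEStronglyMeasurable γ (volume.restrict (Ioo 0 R)) :=
    hγ.continuous.aestronglyMeasurable
  have hγm' : AEStronglyMeasurable (deriv γ) (volume.restrict (Ioo 0 R)) :=
    (measurable_deriv γ).aestronglyMeasurable
  have htest := isTest_radial_mul hγ ht hA
  refine ⟨_, htest, ?_, fun k => ?_⟩
  · refine (eLpNorm_le_of_abs_le_radial (C := C) (F₁ := fun r => g r - γ r) (F₂ := 0)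
      (hgm.sub hγm) aestronglyMeasurable_zero fun x _ => ?_).trans_lt ?_
    · rw [← sub_mul, abs_mul, mul_comm]
      simpa using mul_le_mul_of_nonneg_right (hA.abs_le x) (abs_nonneg _)
    · refine lt_of_le_of_lt ?_ heK
      rw [hK, mul_assoc _ _ e]
      refine mul_le_mul_right ?_ _
      rw [eLpNorm_zero, add_zero]
      refine (eLpNorm_le_mul_eLpNorm_of_ae_le_mul (g := fun r => g r - γ r) (c := R)
        ((ae_restrict_mem measurableSet_Ioo).mono fun r hr => ?_) 2).trans ?_
      · rw [norm_mul, Real.norm_of_nonneg hr.1.le]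
        exact mul_le_mul_of_nonneg_right hr.2.le (norm_nonneg _)
      · exact mul_le_mul' le_add_self h2.le
  · rw [eLpNorm_congr_ae (g := fun x => (deriv g ‖x‖ - deriv γ ‖x‖) * (x k / ‖x‖) * A x +
      (g ‖x‖ - γ ‖x‖) * partialDeriv k A x)]
    · refine (eLpNorm_le_of_abs_le_radial (C := C) (F₁ := fun r => deriv g r - deriv γ r)
        (F₂ := fun r => g r - γ r) (hg.2.1.sub hγm') (hgm.sub hγm)
        fun x hx => hA.abs_radialPartial_le _ _ k hx).trans_lt ?_
      refine lt_of_le_of_lt ?_ heK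
      rw [hK, mul_assoc _ _ e]
      refine mul_le_mul_right ((add_le_add h1.le h2.le).trans ?_) _
      rw [← two_mul]
      exact mul_le_mul_left le_self_add _
    · filter_upwards [ae_ne_zero_droplet R] with x hx
      rw [hasFDerivAt_radial_mul hx (hγ.differentiable (by simp) _)
        ((hA.contDiffAt x hx).differentiableAt (by simp)), radialPartial, radialPartial]
      ring

/-- The profile equal to `1` on `[0, R]` and decreasing linearly to `0` on `[R, 2R]`. -/
noncomputable def plateau (R r : ℝ) : ℝ := min 1 (2 - r / R)

lemma plateau_eq_one {R r : ℝ} (hR : 0 < R) (hr : r ≤ R) : plateau R r = 1 := by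
  refine min_eq_left ?_
  have := (div_le_one hR).2 hr
  linarith

lemma IsProfile.of_lipschitz {R : ℝ} {g : ℝ → ℝ} {K : NNReal} (hg : LipschitzWith K g) :
    IsProfile R g := by
  refine ⟨(hg.lipschitzOnWith (s := uIcc 0 R)).absolutelyContinuousOnInterval, ?_⟩
  exact MemLp.of_bound (measurable_deriv g).aestronglyMeasurable K
    (.of_forall fun r => norm_deriv_le_of_lipschitz hg)

lemma isProfile_plateau {R : ℝ} (hR : 0 < R) (S : ℝ) : IsProfile S (plateau R) := by
  have h : LipschitzWith (Real.toNNReal (1 / R)) (fun r : ℝ => 2 - r / R) := by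
    refine LipschitzWith.of_dist_le_mul fun x y => ?_
    rw [Real.dist_eq, Real.dist_eq, Real.coe_toNNReal _ (by positivity),
      show 2 - x / R - (2 - y / R) = 1 / R * (-(x - y)) by ring, abs_mul, abs_neg,
      abs_of_pos (by positivity : 0 < 1 / R)]
  exact IsProfile.of_lipschitz (h.const_min 1)

/-- `A` itself does not vanish on the sphere of radius `R`. It is therefore cut off by the plateau
on the ball of radius `2R`, where the product is a limit of test functions, and the result is
restricted to the smaller ball. -/
lemma IsAngular.isWeakPartial {R : ℝ} (hR : 0 < R) {A : Space → ℝ} {C : ℝ} (hA : IsAngular A C)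
    (k : Fin 3) : IsWeakPartial (droplet R) k A (partialDeriv k A) := by
  have hsub : droplet R ⊆ droplet (2 * R) := Metric.ball_subset_ball (by linarith)
  have h := (isTestLimit_radial_mul (R := 2 * R) (by linarith) (isProfile_plateau hR _)
    (by simp [plateau, hR.ne']) hA).isWeakPartial k
  refine (h.mono hsub Metric.isOpen_ball.measurableSet).congr Metric.isOpen_ball.measurableSet
    (fun x hx => ?_) (fun x hx => ?_)
  all_goals
    have hx' : ‖x‖ < R := by simpa [droplet] using hx
  · simp [plateau_eq_one hR hx'.le]
  · have : plateau R =ᶠ[nhds ‖x‖] fun _ => (1 : ℝ) := by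
      filter_upwards [Iio_mem_nhds hx'] with y hy using plateau_eq_one hR (le_of_lt hy)
    simp [radialPartial, this.deriv_eq, plateau_eq_one hR hx'.le]

lemma IsAngular.memLp {A : Space → ℝ} {C : ℝ} (hA : IsAngular A C) (R : ℝ) :
    MemLp A 2 (volume.restrict (droplet R)) := by
  have : IsFiniteMeasure (volume.restrict (droplet R)) :=
    ⟨by rw [Measure.restrict_apply_univ]; exact Metric.isBounded_ball.measure_lt_top⟩
  exact MemLp.of_bound hA.aestronglyMeasurable.restrict C (.of_forall hA.abs_le)

lemma IsProfile.sub_const {R : ℝ} {g : ℝ → ℝ} (hg : IsProfile R g) (c : ℝ) :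
    IsProfile R fun r => g r - c := by
  refine ⟨hg.1.fun_sub ((LipschitzWith.const c).lipschitzOnWith).absolutelyContinuousOnInterval, ?_⟩
  have : deriv (fun r => g r - c) = deriv g := by ext r; simp
  rw [this]
  exact hg.2

/-- Splitting `g = (g - g(R)) + g(R)` leaves a profile vanishing at `R` and a constant multiple of
`A`. -/
lemma isWeakPartial_radial_mul {R : ℝ} (hR : 0 < R) {g : ℝ → ℝ} (hg : IsProfile R g)
    {A : Space → ℝ} {C : ℝ} (hA : IsAngular A C) (k : Fin 3) :
    IsWeakPartial (droplet R) k (fun x => g ‖x‖ * A x) (radialPartial g A k) := by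
  have hp := hg.sub_const (g R)
  have h1 := (isTestLimit_radial_mul hR hp (sub_self _) hA).isWeakPartial k
  have h2 := (hA.isWeakPartial hR k).const_smul (g R)
  convert h1.add (memLp_radial_mul hR hp hA) ((hA.memLp R).const_smul (g R)) h2 using 1
  · ext x; simp only [Pi.add_apply, Pi.smul_apply, smul_eq_mul]; ring
  · ext x
    simp only [Pi.add_apply, Pi.smul_apply, smul_eq_mul, radialPartial, deriv_sub_const_fun]; ring

lemma isAngular_const (c : ℝ) : IsAngular (fun _ => c) |c| where
  contDiffAt _ _ := contDiffAt_const
  abs_le _ := le_rfl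
  abs_partialDeriv_le k x _ := by
    simp only [partialDeriv, fderiv_fun_const, Pi.zero_apply, zero_apply, abs_zero]
    positivity

/-! ### The hedgehog tensor as an angular function. -/

/-- The components of `radialTensor`. -/
lemma radialTensor_apply (x : Space) (i j : Fin 3) :
    radialTensor x i j = x i * x j / ‖x‖ ^ 2 - (if i = j then 1 / 3 else 0) := by
  simp only [radialTensor, Matrix.sub_apply, Matrix.smul_apply, Matrix.vecMulVec_apply,
    Matrix.one_apply, smul_eq_mul]
  split_ifs <;> ring

lemma partialDeriv_radialTensor {x : Space} (hx : x ≠ 0) (i j k : Fin 3) :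
    partialDeriv k (fun y => radialTensor y i j) x =
      ((if i = k then x j else 0) + (if j = k then x i else 0)) / ‖x‖ ^ 2
        - 2 * x i * x j * x k / ‖x‖ ^ 4 := by
  have hn : ‖x‖ ^ 2 ≠ 0 := by simpa using hx
  have hi : HasFDerivAt (fun y : Space => y i) (EuclideanSpace.proj i : Space →L[ℝ] ℝ) x :=
    (EuclideanSpace.proj i : Space →L[ℝ] ℝ).hasFDerivAt
  have hj : HasFDerivAt (fun y : Space => y j) (EuclideanSpace.proj j : Space →L[ℝ] ℝ) x :=
    (EuclideanSpace.proj j : Space →L[ℝ] ℝ).hasFDerivAt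
  have hs := (hasStrictFDerivAt_norm_sq x).hasFDerivAt
  have h := ((hi.mul hj).mul ((hasDerivAt_inv hn).comp_hasFDerivAt x hs)).sub_const
    (if i = j then 1 / 3 else 0 : ℝ)
  have e : (fun y => radialTensor y i j) = fun y : Space =>
      y i * y j * (‖y‖ ^ 2)⁻¹ - (if i = j then 1 / 3 else 0) := by
    ext y; rw [radialTensor_apply]; rfl
  rw [partialDeriv, e]
  erw [h.fderiv]
  simp [EuclideanSpace.inner_single_right, PiLp.single_apply]
  have hn' : ‖x‖ ≠ 0 := by simpa using hx
  split_ifs <;> field_simp <;> ring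

lemma isAngular_radialTensor (i j : Fin 3) : IsAngular (fun x => radialTensor x i j) 4 where
  contDiffAt x hx := by
    have hn : ‖x‖ ^ 2 ≠ 0 := by simpa using hx
    have e : (fun y => radialTensor y i j) = fun y : Space =>
        y i * y j / ‖y‖ ^ 2 - (if i = j then 1 / 3 else 0) := by
      ext y; rw [radialTensor_apply]
    rw [e]
    exact (ContDiffAt.div (by fun_prop) (contDiff_norm_sq ℝ).contDiffAt hn).sub contDiffAt_const
  abs_le x := by
    have h1 := abs_apply_div_norm_le x i
    have h2 := abs_apply_div_norm_le x j
    have e : x i * x j / ‖x‖ ^ 2 = (x i / ‖x‖) * (x j / ‖x‖) := by ring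
    rw [radialTensor_apply, e]
    have h3 : |(x i / ‖x‖) * (x j / ‖x‖)| ≤ 1 := by
      rw [abs_mul]; exact mul_le_one₀ h1 (abs_nonneg _) h2
    rw [abs_le] at h3 ⊢
    split_ifs <;> constructor <;> linarith [h3.1, h3.2]
  abs_partialDeriv_le k x hx := by
    have hn : 0 < ‖x‖ := norm_pos_iff.2 hx
    have h1 := abs_apply_div_norm_le x i
    have h2 := abs_apply_div_norm_le x j
    have h3 := abs_apply_div_norm_le x k
    have e : ((if i = k then x j else 0) + (if j = k then x i else 0)) / ‖x‖ ^ 2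
        - 2 * x i * x j * x k / ‖x‖ ^ 4 = ((if i = k then x j / ‖x‖ else 0) +
          (if j = k then x i / ‖x‖ else 0) - 2 * ((x i / ‖x‖) * (x j / ‖x‖) * (x k / ‖x‖)))
          / ‖x‖ := by
      split_ifs <;> field_simp <;> ring
    rw [partialDeriv_radialTensor hx, e, abs_div, abs_norm]
    gcongr
    have h4 : |(x i / ‖x‖) * (x j / ‖x‖) * (x k / ‖x‖)| ≤ 1 := by
      rw [abs_mul, abs_mul]
      exact mul_le_one₀ (mul_le_one₀ h1 (abs_nonneg _) h2) (abs_nonneg _) h3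
    rw [abs_le] at h1 h2 h4 ⊢
    split_ifs <;> constructor <;> linarith [h1.1, h1.2, h2.1, h2.2, h4.1, h4.2]

/-! ### The bulk potential for `t ≥ 200`. -/

lemma two_mul_hPlus_sq {t : ℝ} (ht : 0 ≤ t) : 2 * hPlus t ^ 2 = 3 * hPlus t + t := by
  have := Real.sq_sqrt (show 0 ≤ 9 + 8 * t by linarith)
  rw [hPlus]
  linear_combination this / 8

lemma hPlus_pos (t : ℝ) : 0 < hPlus t := by
  have := Real.sqrt_nonneg (9 + 8 * t)
  rw [hPlus]; linarith

lemma hPlus_div_le {t : ℝ} (ht : 200 ≤ t) : hPlus t / t ≤ 54 / 1000 := by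
  have h1 := Real.sq_sqrt (show 0 ≤ 9 + 8 * t by linarith)
  -- With `S = √(9 + 8t)` one has `8t = (S - 3)(S + 3)`, so the claim is `2 ≤ 0.054 (S - 3)`, true
  -- once `S` exceeds about `40.04`.
  have h2 : 40.05 ≤ √(9 + 8 * t) := Real.le_sqrt_of_sq_le (by norm_num; linarith)
  rw [div_le_iff₀ (by linarith), hPlus]
  nlinarith

lemma hPlus_div_pos {t : ℝ} (ht : 200 ≤ t) : 0 < hPlus t / t :=
  div_pos (hPlus_pos t) (by linarith)

lemma hPlus_sq_div {t : ℝ} (ht : 200 ≤ t) :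
    hPlus t ^ 2 / t = (1 + 3 * (hPlus t / t)) / 2 := by
  have h0 : t ≠ 0 := by linarith
  have := two_mul_hPlus_sq (show 0 ≤ t by linarith)
  field_simp
  linarith

/-- The bulk potential without its additive constant, with `κ = h₊ / t`. -/
lemma radialPotential_eq {t : ℝ} (ht : 200 ≤ t) (s : ℝ) : radialPotential t s =
    -s ^ 2 / 2 - hPlus t / t * s ^ 3 + (1 + 3 * (hPlus t / t)) / 4 * s ^ 4
      + radialPotential t 0 := by
  have h := hPlus_sq_div ht
  have e : hPlus t ^ 2 / (2 * t) = (1 + 3 * (hPlus t / t)) / 4 := by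
    rw [mul_comm, ← div_div, h]; ring
  simp only [radialPotential, e]
  ring

lemma radialPotential_abs_le {t : ℝ} (ht : 200 ≤ t) (s : ℝ) :
    radialPotential t |s| ≤ radialPotential t s := by
  have hk := hPlus_div_pos ht
  have h3 : s ^ 3 ≤ |s| ^ 3 := by rw [← abs_pow]; exact le_abs_self _
  have h4 : |s| ^ 4 = s ^ 4 := by rw [← abs_pow, abs_of_nonneg (by positivity)]
  rw [radialPotential_eq ht |s|, radialPotential_eq ht s, sq_abs, h4]
  nlinarith [mul_le_mul_of_nonneg_left h3 hk.le]

/-- With `K = 3 h₊/t`, the derivative is `s` times `q - 1 - K s + (1 + K) s²`. At `s = ρ` this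
factor is affine in `K`, so it suffices to control the extreme values `K = 0` and `K = 0.162`; these
are the two hypotheses. The margin `0.0058` covers the possible decrease of the quadratic beyond
`ρ`, at most `K²/(4(1 + K)) < 0.0057`. -/
lemma radialPotential_strictMonoOn {t : ℝ} (ht : 200 ≤ t) {q ρ : ℝ} (hρ : 0 < ρ)
    (h1 : 1.0058 - ρ ^ 2 ≤ q) (h2 : 1.0058 + 0.162 * ρ - 1.162 * ρ ^ 2 ≤ q) :
    StrictMonoOn (fun s => radialPotential t s + q / 2 * s ^ 2) (Ici ρ) := by
  set κ := hPlus t / t with hκ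
  have hk0 : 0 < κ := hPlus_div_pos ht
  have hk1 : κ ≤ 54 / 1000 := hPlus_div_le ht
  have hd : ∀ s, HasDerivAt (fun s => radialPotential t s + q / 2 * s ^ 2)
      (s * (q - 1 - 3 * κ * s + (1 + 3 * κ) * s ^ 2)) s := fun s => by
    have h := ((((((hasDerivAt_id s).pow 2).neg.div_const 2).sub
      (((hasDerivAt_id s).pow 3).const_mul κ)).add
      (((hasDerivAt_id s).pow 4).const_mul ((1 + 3 * κ) / 4))).add_const
      (radialPotential t 0)).add (((hasDerivAt_id s).pow 2).const_mul (q / 2))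
    refine (h.congr_of_eventuallyEq (.of_forall fun s => ?_)).congr_deriv ?_
    · simp only [radialPotential_eq ht s, Pi.add_apply, Pi.sub_apply, Pi.neg_apply, Pi.pow_apply,
        id]
      rfl
    · simp only [id]; push_cast; ring
  refine strictMonoOn_of_deriv_pos (convex_Ici ρ)
    (fun s _ => (hd s).continuousAt.continuousWithinAt) fun s hs => ?_
  rw [interior_Ici] at hs
  have hs : ρ < s := hs
  rw [(hd s).deriv]
  refine mul_pos (hρ.trans hs) ?_
  set K := 3 * κ with hK
  have hK1 : K ≤ 0.162 := by rw [hK]; linarith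
  have hK0 : 0 < K := by positivity
  -- Interpolation in `K`: the sign of `ρ - ρ²` decides which endpoint is the worse one.
  have h3 : 1.0058 - ρ ^ 2 + K * (ρ - ρ ^ 2) ≤ q := by
    rcases le_total 0 (ρ - ρ ^ 2) with h | h
    · nlinarith
    · nlinarith
  set d := s - ρ with hd'
  have hd0 : 0 < d := sub_pos.2 hs
  have hsρ : s = ρ + d := by rw [hd']; ring
  have h5 : 0 ≤ K * ρ * d := by positivity
  have h6 : 0 ≤ ρ * d := by positivity
  rw [hsρ]
  -- `0.0698` is close to the maximizer `K/(2(1 + K))` of `K d - (1 + K) d²` at `K = 0.162`.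
  nlinarith [sq_nonneg (d - 0.0698), mul_pos hK0 (pow_pos hd0 2),
    mul_nonneg (sub_nonneg.2 hK1) hd0.le]

/-! ### The explicit barrier. -/

/-- A supersolution of the radial Euler-Lagrange equation. -/
noncomputable def barrier (r : ℝ) : ℝ := 1.05 * (r ^ 2 * (r ^ 2 + 22)) / (r ^ 2 + 12) ^ 2

/-- The function `r² ρ' / ρ` for the barrier `ρ`. -/
noncomputable def barrierSlope (r : ℝ) : ℝ :=
  4 * r * (r ^ 2 + 132) / ((r ^ 2 + 22) * (r ^ 2 + 12))

/-- The quotient `-(ρ'' + 2 ρ' / r - 6 ρ / r²) / ρ` for the barrier `ρ`. -/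
noncomputable def barrierQuotient (r : ℝ) : ℝ :=
  (6 * r ^ 4 + 280 * r ^ 2 + 5376) / ((r ^ 2 + 22) * (r ^ 2 + 12) ^ 2)

lemma barrier_pos {r : ℝ} (hr : 0 < r) : 0 < barrier r := by
  unfold barrier; positivity

lemma barrier_nonneg (r : ℝ) : 0 ≤ barrier r := by
  unfold barrier; positivity

lemma one_le_barrier {R : ℝ} (hR : 10 ≤ R) : 1 ≤ barrier R := by
  rw [barrier, le_div_iff₀ (by positivity)]
  have : 100 ≤ R ^ 2 := by nlinarith
  nlinarith

lemma hasDerivAt_barrier {r : ℝ} (hr : r ≠ 0) :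
    HasDerivAt barrier (barrierSlope r * barrier r / r ^ 2) r := by
  have h1 : HasDerivAt (fun r : ℝ => r ^ 2) (2 * r) r := by simpa using hasDerivAt_pow 2 r
  have h := ((h1.mul (h1.add_const 22)).const_mul 1.05).div ((h1.add_const 12).pow 2)
    (by simp only [Pi.pow_apply]; positivity)
  refine h.congr_deriv ?_
  have a : r ^ 2 + 12 ≠ 0 := by positivity
  have b : r ^ 2 + 22 ≠ 0 := by positivity
  simp only [barrierSlope, barrier, Pi.mul_apply, Pi.pow_apply]
  field_simp
  push_cast
  ring

/-- This is the Riccati equation for `p = r² ρ'/ρ`, equivalent to the linear second-order equation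
for `ρ` with potential `q`. It is what makes the completion of the square in `excess_nonneg` exact.
-/
lemma hasDerivAt_barrierSlope {r : ℝ} (hr : r ≠ 0) : HasDerivAt barrierSlope
    (6 - r ^ 2 * barrierQuotient r - barrierSlope r ^ 2 / r ^ 2) r := by
  have h1 : HasDerivAt (fun r : ℝ => r ^ 2) (2 * r) r := by simpa using hasDerivAt_pow 2 r
  have h := (((hasDerivAt_id r).const_mul 4).mul (h1.add_const 132)).div
    ((h1.add_const 22).mul (h1.add_const 12)) (by simp only [Pi.mul_apply]; positivity)
  refine h.congr_deriv ?_
  have a : r ^ 2 + 12 ≠ 0 := by positivity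
  have b : r ^ 2 + 22 ≠ 0 := by positivity
  simp only [barrierSlope, barrierQuotient, Pi.mul_apply, id]
  field_simp
  ring

lemma contDiff_barrier : ContDiff ℝ 1 barrier := by
  unfold barrier
  exact ContDiff.div (by fun_prop) (by fun_prop) fun r => by positivity

lemma contDiff_barrierSlope : ContDiff ℝ 1 barrierSlope := by
  unfold barrierSlope
  exact ContDiff.div (by fun_prop) (by fun_prop) fun r => by positivity

/-- The endpoint `K = 0` of the supersolution condition. In `u = r²` it becomes positivity of a
quintic on `u ≥ 0`, whose leading coefficient `1.05² - 1.0058` is positive; here the factor `1.05`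
in the barrier is needed. -/
lemma barrierQuotient_ge_sq (r : ℝ) : 1.0058 - barrier r ^ 2 ≤ barrierQuotient r := by
  have hu : 0 ≤ r ^ 2 := sq_nonneg r
  rw [sub_le_iff_le_add, barrierQuotient, barrier, div_pow, ← pow_mul]
  rw [show r ^ 4 = (r ^ 2) ^ 2 by ring]
  generalize r ^ 2 = u at hu ⊢
  rw [div_add_div _ _ (by positivity) (by positivity), le_div_iff₀ (by positivity)]
  have key : 0 ≤ 315306.0864 - 4458.24 * u - 1370.916 * u ^ 2 + 93.694 * u ^ 3 + 8.359 * u ^ 4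
      + 0.0967 * u ^ 5 := by
    nlinarith [mul_nonneg hu (sq_nonneg (u - 8)), sq_nonneg (u ^ 2 - 80), pow_nonneg hu 5,
      sq_nonneg (u - 10), pow_nonneg hu 3]
  -- Adding the fractions over the product of their denominators, not the least common one, leaves
  -- the spare factor `(u + 12)²`.
  nlinarith [mul_nonneg key (by positivity : 0 ≤ (u + 12) ^ 2)]

/-- The endpoint `K = 0.162`, again positivity of a quintic in `u = r²`. -/
lemma barrierQuotient_ge (r : ℝ) :
    1.0058 + 0.162 * barrier r - 1.162 * barrier r ^ 2 ≤ barrierQuotient r := by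
  have hu : 0 ≤ r ^ 2 := sq_nonneg r
  rw [sub_le_iff_le_add, barrierQuotient, barrier, div_pow, ← pow_mul]
  rw [show r ^ 4 = (r ^ 2) ^ 2 by ring]
  generalize r ^ 2 = u at hu ⊢
  have key : 0 ≤ 315306.0864 - 16313.5296 * u - 2522.76516 * u ^ 2 + 66.58006 * u ^ 3
      + 8.58013 * u ^ 4 + 0.105205 * u ^ 5 := by
    nlinarith [mul_nonneg hu (sq_nonneg (u - 10)), sq_nonneg (u ^ 2 - 110), pow_nonneg hu 5,
      sq_nonneg (u - 10), pow_nonneg hu 3]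
  have e : (6 * u ^ 2 + 280 * u + 5376) / ((u + 22) * (u + 12) ^ 2) +
      1.162 * ((1.05 * (u * (u + 22))) ^ 2 / (u + 12) ^ (2 * 2)) -
      (1.0058 + 0.162 * (1.05 * (u * (u + 22)) / (u + 12) ^ 2)) =
      (315306.0864 - 16313.5296 * u - 2522.76516 * u ^ 2 + 66.58006 * u ^ 3
      + 8.58013 * u ^ 4 + 0.105205 * u ^ 5) / ((u + 22) * (u + 12) ^ 4) := by
    field_simp
    ring
  have := div_nonneg key (by positivity : 0 ≤ (u + 22) * (u + 12) ^ 4)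
  linarith

/-! ### Comparison of a minimizer with the barrier. -/

/-- The integrand of the radial energy. -/
noncomputable def radialDensity (t : ℝ) (h : ℝ → ℝ) (r : ℝ) : ℝ :=
  r ^ 2 * (1 / 2 * deriv h r ^ 2 + 3 * h r ^ 2 / r ^ 2 + radialPotential t (h r))

lemma radialEnergy_eq {t R : ℝ} (hR : 0 ≤ R) (h : ℝ → ℝ) :
    radialEnergy t R h = ∫ r in Ioo 0 R, radialDensity t h r := by
  rw [radialEnergy, intervalIntegral.integral_of_le hR, integral_Ioc_eq_integral_Ioo]
  rfl

lemma continuous_radialPotential (t : ℝ) : Continuous (radialPotential t) := by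
  unfold radialPotential
  fun_prop

lemma integrableOn_Ioo_of_continuousOn {R : ℝ} {f : ℝ → ℝ} (hf : ContinuousOn f (Icc 0 R)) :
    IntegrableOn f (Ioo 0 R) :=
  (hf.integrableOn_compact isCompact_Icc).mono_set Ioo_subset_Icc_self

lemma IsProfile.integrableOn_radialDensity {t R : ℝ} (hR : 0 < R) {h : ℝ → ℝ}
    (hh : IsProfile R h) : IntegrableOn (radialDensity t h) (Ioo 0 R) := by
  have hc := hh.continuousOn hR
  have h1 : IntegrableOn (fun r => 1 / 2 * (r * deriv h r) ^ 2) (Ioo 0 R) :=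
    (memLp_id_mul hh.2).integrable_sq.const_mul _
  have h2 : IntegrableOn (fun r => 3 * h r ^ 2 + r ^ 2 * radialPotential t (h r)) (Ioo 0 R) :=
    integrableOn_Ioo_of_continuousOn ((continuousOn_const.mul (hc.pow 2)).add
      ((continuousOn_pow 2).mul ((continuous_radialPotential t).comp_continuousOn hc)))
  refine (h1.add h2).congr_fun (fun r hr => ?_) measurableSet_Ioo
  have : r ≠ 0 := hr.1.ne'
  simp only [radialDensity, Pi.add_apply]
  field_simp
  ring

lemma AbsolutelyContinuousOnInterval.min_abs {a b : ℝ} {f g : ℝ → ℝ}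
    (hf : AbsolutelyContinuousOnInterval f a b) (hg : AbsolutelyContinuousOnInterval g a b) :
    AbsolutelyContinuousOnInterval (fun x => min |f x| (g x)) a b := by
  refine squeeze_zero (fun t => ?_) (fun t => ?_) (by simpa using Filter.Tendsto.add hf hg)
  · exact Finset.sum_nonneg fun i _ => dist_nonneg
  · rw [← Finset.sum_add_distrib]
    refine Finset.sum_le_sum fun i _ => ?_
    simp only [Real.dist_eq]
    refine (abs_min_sub_min_le_max _ _ _ _).trans (max_le ?_ ?_)
    · exact (abs_abs_sub_abs_le _ _).trans (le_add_of_nonneg_right (abs_nonneg _))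
    · exact le_add_of_nonneg_left (abs_nonneg _)

/-- If `f ≤ g` with equality at `x`, the derivatives at `x` agree. -/
lemma deriv_eq_of_le_of_eq {f g : ℝ → ℝ} {f' g' x : ℝ} (hf : HasDerivAt f f' x)
    (hg : HasDerivAt g g' x) (hle : ∀ᶠ y in nhds x, f y ≤ g y) (heq : f x = g x) : f' = g' := by
  have hmin : IsLocalMin (fun y => g y - f y) x := by
    filter_upwards [hle] with y hy
    simpa [heq] using hy
  have := hmin.hasDerivAt_eq_zero (hg.sub hf)
  linarith

/-- The truncation `min |h| ρ` of `h` by the barrier. -/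
noncomputable def truncation (h : ℝ → ℝ) (r : ℝ) : ℝ := min |h r| (barrier r)

lemma truncation_nonneg (h : ℝ → ℝ) (r : ℝ) : 0 ≤ truncation h r :=
  le_min (abs_nonneg _) (barrier_nonneg r)

/-- At a common point of differentiability, the truncation follows the barrier where `ρ < |h|`,
and otherwise it follows `h` up to a sign. -/
lemma deriv_truncation_cases {h : ℝ → ℝ} {r : ℝ} (hr : 0 < r) (hh : DifferentiableAt ℝ h r)
    (ht : DifferentiableAt ℝ (truncation h) r) :
    (barrier r < |h r| ∧ truncation h r = barrier r ∧
      deriv (truncation h) r = barrierSlope r * barrier r / r ^ 2) ∨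
    (|h r| ≤ barrier r ∧ truncation h r = |h r| ∧
      ((h r = 0 ∧ deriv (truncation h) r = 0) ∨
        ∃ s : ℝ, s ^ 2 = 1 ∧ truncation h r = s * h r ∧
          deriv (truncation h) r = s * deriv h r)) := by
  rcases lt_or_ge (barrier r) |h r| with hlt | hle
  · have e : truncation h r = barrier r := min_eq_right hlt.le
    exact Or.inl ⟨hlt, e, deriv_eq_of_le_of_eq ht.hasDerivAt (hasDerivAt_barrier hr.ne')
      (.of_forall fun y => min_le_right _ _) e⟩
  · have e : truncation h r = |h r| := min_eq_left hle
    refine Or.inr ⟨hle, e, ?_⟩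
    rcases lt_trichotomy (h r) 0 with h0 | h0 | h0
    · refine Or.inr ⟨-1, by norm_num, by rw [e, abs_of_neg h0]; ring, ?_⟩
      rw [neg_one_mul]
      refine deriv_eq_of_le_of_eq ht.hasDerivAt hh.hasDerivAt.neg ?_
        (by rw [e, abs_of_neg h0]; rfl)
      filter_upwards [hh.continuousAt.eventually_lt continuousAt_const h0] with y hy
      exact (min_le_left _ _).trans_eq (abs_of_neg hy)
    · refine Or.inl ⟨h0, (deriv_eq_of_le_of_eq (hasDerivAt_const r (0 : ℝ)) ht.hasDerivAt
        (.of_forall fun y => truncation_nonneg h y) (by simp [e, h0])).symm⟩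
    · refine Or.inr ⟨1, by norm_num, by rw [e, abs_of_pos h0, one_mul], ?_⟩
      rw [one_mul]
      refine deriv_eq_of_le_of_eq ht.hasDerivAt hh.hasDerivAt ?_ (by rw [e, abs_of_pos h0])
      filter_upwards [continuousAt_const.eventually_lt hh.continuousAt h0] with y hy
      exact (min_le_left _ _).trans_eq (abs_of_pos hy)

lemma IsProfile.ae_differentiableAt {R : ℝ} (hR : 0 < R) {g : ℝ → ℝ} (hg : IsProfile R g) :
    ∀ᵐ r ∂volume.restrict (Ioo 0 R), DifferentiableAt ℝ g r := by
  rw [ae_restrict_iff' measurableSet_Ioo]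
  filter_upwards [hg.1.ae_differentiableAt] with r h hr
  exact h (by rw [uIcc_of_le hR.le]; exact ⟨hr.1.le, hr.2.le⟩)

lemma _root_.ContDiff.isProfile {R : ℝ} {g : ℝ → ℝ} (hg : ContDiff ℝ 1 g) : IsProfile R g := by
  refine ⟨hg.contDiffOn.absolutelyContinuousOnInterval, ?_⟩
  have hc : Continuous (deriv g) := hg.continuous_deriv le_rfl
  obtain ⟨C, hC⟩ := isCompact_Icc.exists_bound_of_continuousOn (s := Icc 0 R) hc.continuousOn
  exact MemLp.of_bound hc.aestronglyMeasurable C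
    ((ae_restrict_mem measurableSet_Ioo).mono fun r hr => hC r ⟨hr.1.le, hr.2.le⟩)

/-- Almost everywhere the derivative of the truncation is, up to sign, that of `h` or of the
barrier, or zero; hence it is dominated by a square-integrable function. -/
lemma IsProfile.truncation {R : ℝ} (hR : 0 < R) {h : ℝ → ℝ} (hh : IsProfile R h) :
    IsProfile R (truncation h) := by
  have hac : AbsolutelyContinuousOnInterval (LandauDeGennes.truncation h) 0 R :=
    AbsolutelyContinuousOnInterval.min_abs hh.1 contDiff_barrier.isProfile.1
  refine ⟨hac, ?_⟩
  have hd : ∀ᵐ r ∂volume.restrict (Ioo 0 R),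
      DifferentiableAt ℝ (LandauDeGennes.truncation h) r := by
    rw [ae_restrict_iff' measurableSet_Ioo]
    filter_upwards [hac.ae_differentiableAt] with r h hr
    exact h (by rw [uIcc_of_le hR.le]; exact ⟨hr.1.le, hr.2.le⟩)
  have hb : MemLp (fun r => |deriv h r| + |deriv barrier r|) 2 (volume.restrict (Ioo 0 R)) :=
    hh.2.abs.add (contDiff_barrier.isProfile (R := R)).2.abs
  refine hb.mono (measurable_deriv _).aestronglyMeasurable ?_
  filter_upwards [hd, hh.ae_differentiableAt hR, ae_restrict_mem measurableSet_Ioo]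
    with r h1 h2 hr
  rw [Real.norm_eq_abs, Real.norm_of_nonneg (by positivity)]
  rcases deriv_truncation_cases hr.1 h2 h1 with ⟨-, -, e⟩ | ⟨-, -, ⟨-, e⟩ | ⟨s, hs, -, e⟩⟩
  · rw [e, ← (hasDerivAt_barrier hr.1.ne').deriv]
    exact le_add_of_nonneg_left (abs_nonneg _)
  · rw [e, abs_zero]; positivity
  · have : |s| = 1 := by rcases sq_eq_one_iff.1 hs with rfl | rfl <;> simp
    rw [e, abs_mul, this, one_mul]
    exact le_add_of_nonneg_right (abs_nonneg _)

/-- The energy excess of `h` over its truncation, up to a null Lagrangian. -/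
noncomputable def excess (t : ℝ) (h : ℝ → ℝ) (r : ℝ) : ℝ :=
  radialDensity t h r - radialDensity t (truncation h) r -
    deriv (fun r => barrierSlope r / 2 * (h r * h r - truncation h r * truncation h r)) r

/-- Completing the square with the Riccati equation writes the excess as a difference of squares `(r
h' - p h/r)²/2` plus `r² (F(h) - F(T))`, with `F(s) = f(s) + q s²/2`. Where the barrier is exceeded,
`T = ρ` annihilates its square and `F` is strictly increasing above `ρ`. Elsewhere the square of `T`
is at most that of `h`, and `F(|h|) ≤ F(h)` because the cubic term of `f` favours positive values.
-/
lemma excess_nonneg {t : ℝ} (ht : 200 ≤ t) {h : ℝ → ℝ} {r : ℝ} (hr : 0 < r)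
    (hh : DifferentiableAt ℝ h r) (hT : DifferentiableAt ℝ (truncation h) r) :
    0 ≤ excess t h r ∧ (barrier r < |h r| → 0 < excess t h r) := by
  have hr0 : r ≠ 0 := hr.ne'
  set T := truncation h with hTdef
  set F : ℝ → ℝ := fun s => radialPotential t s + barrierQuotient r / 2 * s ^ 2 with hF
  have hG := ((hasDerivAt_barrierSlope hr0).div_const 2).mul
    ((hh.hasDerivAt.mul hh.hasDerivAt).sub (hT.hasDerivAt.mul hT.hasDerivAt))
  have e : excess t h r = 1 / 2 * (r * deriv h r - barrierSlope r * h r / r) ^ 2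
      - 1 / 2 * (r * deriv T r - barrierSlope r * T r / r) ^ 2
      + r ^ 2 * (F (h r) - F (T r)) := by
    have hG' : deriv (fun r => barrierSlope r / 2 * (h r * h r - T r * T r)) r = _ := hG.deriv
    rw [excess, ← hTdef, hG']
    simp only [radialDensity, hF, Pi.sub_apply, Pi.mul_apply]
    field_simp
    ring
  have hFabs : F |h r| ≤ F (h r) := by
    simp only [hF, sq_abs]
    linarith [radialPotential_abs_le ht (h r)]
  have hmono := radialPotential_strictMonoOn ht (barrier_pos hr) (barrierQuotient_ge_sq r)
    (barrierQuotient_ge r)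
  have hr2 : 0 < r ^ 2 := by positivity
  have hcases := deriv_truncation_cases hr hh hT
  rw [← hTdef] at hcases
  rw [e]
  rcases hcases with ⟨hlt, e1, e2⟩ | ⟨hle, e1, hc⟩
  · have e3 : r * deriv T r - barrierSlope r * T r / r = 0 := by
      rw [e2, e1]; field_simp; ring
    have h4 : F (T r) < F (h r) := by
      rw [e1]
      exact (hmono (mem_Ici.2 le_rfl) (mem_Ici.2 hlt.le) hlt).trans_le hFabs
    rw [e3]
    have : 0 < r ^ 2 * (F (h r) - F (T r)) := mul_pos hr2 (sub_pos.2 h4)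
    have h5 : 0 < 1 / 2 * (r * deriv h r - barrierSlope r * h r / r) ^ 2 - 1 / 2 * 0 ^ 2
        + r ^ 2 * (F (h r) - F (T r)) := by
      nlinarith [sq_nonneg (r * deriv h r - barrierSlope r * h r / r)]
    exact ⟨h5.le, fun _ => h5⟩
  · have h4 : 0 ≤ r ^ 2 * (F (h r) - F (T r)) := by
      rw [e1]; exact mul_nonneg hr2.le (sub_nonneg.2 hFabs)
    refine ⟨?_, fun hlt => absurd hlt (not_lt.2 hle)⟩
    rcases hc with ⟨h0, e2⟩ | ⟨s, hs, e2, e3⟩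
    · have hT0 : T r = 0 := by rw [e1, h0, abs_zero]
      rw [hT0] at h4
      rw [e2, hT0, show r * 0 - barrierSlope r * 0 / r = 0 by simp]
      nlinarith [sq_nonneg (r * deriv h r - barrierSlope r * h r / r)]
    · rw [e2] at h4
      have : (r * (s * deriv h r) - barrierSlope r * (s * h r) / r) ^ 2 =
          (r * deriv h r - barrierSlope r * h r / r) ^ 2 := by
        linear_combination (r * deriv h r - barrierSlope r * h r / r) ^ 2 * hs
      rw [e3, e2, this]
      linarith

/-- A minimizing profile lies below the barrier. -/
theorem IsHedgehogProfile.abs_le_barrier {t R : ℝ} (ht : 200 ≤ t) (hR : 10 ≤ R) {h : ℝ → ℝ}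
    (hh : IsHedgehogProfile t R h) :
    ∀ᵐ r ∂volume.restrict (Ioo 0 R), |h r| ≤ barrier r := by
  have hR0 : 0 < R := by linarith
  have hp : IsProfile R h := ⟨hh.1.1, hh.1.2.1⟩
  have hpT := hp.truncation hR0
  have hTR : truncation h R = 1 := by
    rw [truncation, hh.1.2.2, abs_one]; exact min_eq_left (one_le_barrier hR)
  have hmin : radialEnergy t R h ≤ radialEnergy t R (truncation h) := hh.2 ⟨hpT.1, hpT.2, hTR⟩
  have hG : AbsolutelyContinuousOnInterval
      (fun r => barrierSlope r / 2 * (h r * h r - truncation h r * truncation h r)) 0 R := by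
    have h1 : AbsolutelyContinuousOnInterval (fun r => barrierSlope r / 2) 0 R :=
      (contDiff_barrierSlope.div_const 2).contDiffOn.absolutelyContinuousOnInterval
    exact h1.fun_mul ((hp.1.fun_mul hp.1).fun_sub (hpT.1.fun_mul hpT.1))
  have hGi := hG.integral_deriv_eq_sub
  rw [hh.1.2.2, hTR, intervalIntegral.integral_of_le hR0.le, integral_Ioc_eq_integral_Ioo] at hGi
  have hGint : IntegrableOn (deriv fun r => barrierSlope r / 2 *
      (h r * h r - truncation h r * truncation h r)) (Ioo 0 R) :=
    ((intervalIntegrable_iff_integrableOn_Ioc_of_le hR0.le).1 hG.intervalIntegrable_deriv).mono_set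
      Ioo_subset_Ioc_self
  have i1 := hp.integrableOn_radialDensity (t := t) hR0
  have i2 := hpT.integrableOn_radialDensity (t := t) hR0
  have hint : IntegrableOn (excess t h) (Ioo 0 R) := (i1.sub i2).sub hGint
  have hae : ∀ᵐ r ∂volume.restrict (Ioo 0 R),
      0 ≤ excess t h r ∧ (barrier r < |h r| → 0 < excess t h r) := by
    filter_upwards [hp.ae_differentiableAt hR0, hpT.ae_differentiableAt hR0,
      ae_restrict_mem measurableSet_Ioo] with r h1 h2 hr using excess_nonneg ht hr.1 h1 h2
  have hle : ∫ r in Ioo 0 R, excess t h r ≤ 0 := by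
    have e1 := integral_sub (i1.sub i2) hGint
    have e2 := integral_sub i1 i2
    simp only [Pi.sub_apply] at e1
    simp only [excess]
    rw [e1, e2, hGi, ← radialEnergy_eq hR0.le, ← radialEnergy_eq hR0.le]
    -- The boundary terms of the null Lagrangian vanish: at `R` both functions equal `1`, and at `0`
    -- the slope factor is `0`, so no information on `h(0)` is needed.
    simp only [barrierSlope]
    norm_num
    linarith
  have hzero : ∫ r in Ioo 0 R, excess t h r = 0 :=
    le_antisymm hle (integral_nonneg_of_ae (hae.mono fun r h => h.1))
  rw [integral_eq_zero_iff_of_nonneg_ae (hae.mono fun r h => h.1) hint] at hzero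
  filter_upwards [hae, hzero] with r h1 h2
  by_contra hc
  exact (h1.2 (not_le.1 hc)).ne' h2

/-! ### Angular averages by symmetry. -/

lemma setIntegral_comp_isometry (T : Space ≃ₗᵢ[ℝ] Space) (R : ℝ) (G : Space → ℝ) :
    ∫ x in droplet R, G (T x) = ∫ x in droplet R, G x := by
  have h := T.measurePreserving.setIntegral_preimage_emb
    T.toHomeomorph.measurableEmbedding G (droplet R)
  have e : T ⁻¹' droplet R = droplet R := by ext x; simp [droplet]
  rwa [e] at h

lemma setIntegral_comp_perm (σ : Equiv.Perm (Fin 3)) (R : ℝ) (F : ℝ → ℝ)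
    (G : (Fin 3 → ℝ) → ℝ) :
    ∫ x in droplet R, F ‖x‖ * G (fun i => x (σ i) / ‖x‖)
      = ∫ x in droplet R, F ‖x‖ * G (fun i => x i / ‖x‖) := by
  rw [← setIntegral_comp_isometry (LinearIsometryEquiv.piLpCongrLeft 2 ℝ ℝ σ)]
  simp

/-- The orthogonal map rotating the first two coordinate axes to their diagonals. -/
noncomputable def diagonalMap : Space →ₗ[ℝ] Space where
  toFun x := !₂[(x 0 + x 1) / √2, (x 0 - x 1) / √2, x 2]
  map_add' x y := by
    ext i; fin_cases i <;> simp <;> ring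
  map_smul' c x := by
    ext i; fin_cases i <;> simp <;> ring

lemma norm_diagonalMap (x : Space) : ‖diagonalMap x‖ = ‖x‖ := by
  have h2 : √2 ^ 2 = 2 := Real.sq_sqrt (by norm_num)
  rw [← sq_eq_sq₀ (norm_nonneg _) (norm_nonneg _), EuclideanSpace.real_norm_sq_eq,
    EuclideanSpace.real_norm_sq_eq, Fin.sum_univ_three, Fin.sum_univ_three]
  simp [diagonalMap, div_pow, h2]
  ring

/-- `diagonalMap` as an isometry. -/
noncomputable def diagonalIsometry : Space ≃ₗᵢ[ℝ] Space :=
  LinearIsometry.toLinearIsometryEquiv ⟨diagonalMap, norm_diagonalMap⟩ rfl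

lemma diagonalIsometry_apply (x : Space) :
    diagonalIsometry x = !₂[(x 0 + x 1) / √2, (x 0 - x 1) / √2, x 2] := rfl

lemma sum_sq_div_norm {x : Space} (hx : x ≠ 0) :
    (x 0 / ‖x‖) ^ 2 + (x 1 / ‖x‖) ^ 2 + (x 2 / ‖x‖) ^ 2 = 1 := by
  have h : ‖x‖ ^ 2 = x 0 ^ 2 + x 1 ^ 2 + x 2 ^ 2 := by
    rw [EuclideanSpace.real_norm_sq_eq, Fin.sum_univ_three]
  have hn : ‖x‖ ≠ 0 := norm_ne_zero_iff.2 hx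
  field_simp
  exact h.symm

/-- Bounded continuous functions of the direction may be integrated against a radial one. -/
lemma integrableOn_radial_mul {R : ℝ} {F : ℝ → ℝ}
    (hF : IntegrableOn (fun x : Space => F ‖x‖) (droplet R)) {G : (Fin 3 → ℝ) → ℝ}
    (hG : Continuous G) :
    IntegrableOn (fun x : Space => F ‖x‖ * G (fun i => x i / ‖x‖)) (droplet R) := by
  obtain ⟨C, hC⟩ := (isCompact_univ_pi fun _ : Fin 3 =>
    isCompact_Icc (a := (-1 : ℝ)) (b := 1)).exists_bound_of_continuousOn hG.continuousOn
  have hm : Measurable fun x : Space => G fun i => x i / ‖x‖ :=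
    hG.measurable.comp (measurable_pi_lambda _ fun i => by fun_prop)
  refine Integrable.mul_bdd (c := C) hF hm.aestronglyMeasurable (.of_forall fun x => ?_)
  exact hC _ (mem_univ_pi.2 fun i => abs_le.1 (abs_apply_div_norm_le x i))

section Averages

variable {R : ℝ} {F : ℝ → ℝ}

lemma setIntegral_radial_congr {G H : (Fin 3 → ℝ) → ℝ}
    (h : ∀ n : Fin 3 → ℝ, n 0 ^ 2 + n 1 ^ 2 + n 2 ^ 2 = 1 → G n = H n) :
    ∫ x in droplet R, F ‖x‖ * G (fun i => x i / ‖x‖)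
      = ∫ x in droplet R, F ‖x‖ * H (fun i => x i / ‖x‖) := by
  refine integral_congr_ae ?_
  filter_upwards [ae_ne_zero_droplet R] with x hx
  rw [h _ (sum_sq_div_norm hx)]

lemma setIntegral_radial_add (hF : IntegrableOn (fun x : Space => F ‖x‖) (droplet R))
    {G H : (Fin 3 → ℝ) → ℝ} (hG : Continuous G) (hH : Continuous H) :
    ∫ x in droplet R, F ‖x‖ * (G (fun i => x i / ‖x‖) + H (fun i => x i / ‖x‖))
      = (∫ x in droplet R, F ‖x‖ * G (fun i => x i / ‖x‖))
        + ∫ x in droplet R, F ‖x‖ * H (fun i => x i / ‖x‖) := by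
  simp only [mul_add]
  exact integral_add (integrableOn_radial_mul hF hG) (integrableOn_radial_mul hF hH)

lemma setIntegral_radial_const_mul (c : ℝ) (G : (Fin 3 → ℝ) → ℝ) :
    ∫ x in droplet R, F ‖x‖ * (c * G (fun i => x i / ‖x‖))
      = c * ∫ x in droplet R, F ‖x‖ * G (fun i => x i / ‖x‖) := by
  rw [← integral_const_mul]
  congr 1; ext x; ring

/-- The three coordinates contribute equally and their squares sum to `1`. -/
lemma setIntegral_sq (hF : IntegrableOn (fun x : Space => F ‖x‖) (droplet R)) :
    ∫ x in droplet R, F ‖x‖ * (x 2 / ‖x‖) ^ 2 = 1 / 3 * ∫ x in droplet R, F ‖x‖ := by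
  have h0 := setIntegral_comp_perm (Equiv.swap 0 2) R F (fun n => n 2 ^ 2)
  have h1 := setIntegral_comp_perm (Equiv.swap 1 2) R F (fun n => n 2 ^ 2)
  have hs := setIntegral_radial_congr (R := R) (F := F)
    (G := fun n => n 0 ^ 2 + (n 1 ^ 2 + n 2 ^ 2)) (H := fun _ => 1) fun n hn => by linarith
  rw [setIntegral_radial_add hF (G := fun n => n 0 ^ 2) (H := fun n => n 1 ^ 2 + n 2 ^ 2)
      (by fun_prop) (by fun_prop),
    setIntegral_radial_add hF (G := fun n => n 1 ^ 2) (H := fun n => n 2 ^ 2)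
      (by fun_prop) (by fun_prop)] at hs
  simp only [Equiv.swap_apply_right, mul_one] at h0 h1 hs
  linarith

/-- Let `M₄` and `M₂₂` be the means of `n₀⁴` and `n₀² n₁²`. Squaring `|n|² = 1` gives `3 M₄ + 6 M₂₂
= 1`, and invariance under the diagonal isometry gives `M₂₂ = M₄/2 - M₂₂/2`; hence `M₄ = 1/5`. -/
lemma setIntegral_fourth (hF : IntegrableOn (fun x : Space => F ‖x‖) (droplet R)) :
    ∫ x in droplet R, F ‖x‖ * (x 2 / ‖x‖) ^ 4 = 1 / 5 * ∫ x in droplet R, F ‖x‖ := by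
  have a0 := setIntegral_comp_perm (Equiv.swap 0 2) R F (fun n => n 2 ^ 4)
  have a1 := setIntegral_comp_perm (Equiv.swap 1 2) R F (fun n => n 2 ^ 4)
  have b0 := setIntegral_comp_perm (Equiv.swap 1 2) R F (fun n => n 0 ^ 2 * n 1 ^ 2)
  have b1 := setIntegral_comp_perm (Equiv.swap 0 2) R F (fun n => n 0 ^ 2 * n 1 ^ 2)
  have hs := setIntegral_radial_congr (R := R) (F := F)
    (G := fun n => n 0 ^ 4 + (n 1 ^ 4 + (n 2 ^ 4 + (2 * (n 0 ^ 2 * n 1 ^ 2) +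
      (2 * (n 0 ^ 2 * n 2 ^ 2) + 2 * (n 2 ^ 2 * n 1 ^ 2)))))) (H := fun _ => 1) fun n hn => by
        linear_combination (n 0 ^ 2 + n 1 ^ 2 + n 2 ^ 2 + 1) * hn
  rw [setIntegral_radial_add hF (G := fun n => n 0 ^ 4)
      (H := fun n => n 1 ^ 4 + (n 2 ^ 4 + (2 * (n 0 ^ 2 * n 1 ^ 2) +
        (2 * (n 0 ^ 2 * n 2 ^ 2) + 2 * (n 2 ^ 2 * n 1 ^ 2))))) (by fun_prop) (by fun_prop),
    setIntegral_radial_add hF (G := fun n => n 1 ^ 4)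
      (H := fun n => n 2 ^ 4 + (2 * (n 0 ^ 2 * n 1 ^ 2) +
        (2 * (n 0 ^ 2 * n 2 ^ 2) + 2 * (n 2 ^ 2 * n 1 ^ 2)))) (by fun_prop) (by fun_prop),
    setIntegral_radial_add hF (G := fun n => n 2 ^ 4)
      (H := fun n => 2 * (n 0 ^ 2 * n 1 ^ 2) +
        (2 * (n 0 ^ 2 * n 2 ^ 2) + 2 * (n 2 ^ 2 * n 1 ^ 2))) (by fun_prop) (by fun_prop),
    setIntegral_radial_add hF (G := fun n => 2 * (n 0 ^ 2 * n 1 ^ 2))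
      (H := fun n => 2 * (n 0 ^ 2 * n 2 ^ 2) + 2 * (n 2 ^ 2 * n 1 ^ 2)) (by fun_prop) (by fun_prop),
    setIntegral_radial_add hF (G := fun n => 2 * (n 0 ^ 2 * n 2 ^ 2))
      (H := fun n => 2 * (n 2 ^ 2 * n 1 ^ 2)) (by fun_prop) (by fun_prop),
    setIntegral_radial_const_mul 2 fun n => n 0 ^ 2 * n 1 ^ 2,
    setIntegral_radial_const_mul 2 fun n => n 0 ^ 2 * n 2 ^ 2,
    setIntegral_radial_const_mul 2 fun n => n 2 ^ 2 * n 1 ^ 2] at hs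
  -- Coordinate permutations cannot relate the two kinds of fourth moments; the diagonal isometry
  -- turns `n₀² n₁²` into `(n₀² - n₁²)²/4`.
  have hd := setIntegral_comp_isometry diagonalIsometry R
    fun x => F ‖x‖ * ((x 0 / ‖x‖) ^ 2 * (x 1 / ‖x‖) ^ 2)
  have hd' : ∀ x : Space, F ‖diagonalIsometry x‖ *
      ((diagonalIsometry x 0 / ‖diagonalIsometry x‖) ^ 2
      * (diagonalIsometry x 1 / ‖diagonalIsometry x‖) ^ 2) =
      F ‖x‖ * (1 / 4 * (x 0 / ‖x‖) ^ 4 + (1 / 4 * (x 1 / ‖x‖) ^ 4 +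
        -1 / 2 * ((x 0 / ‖x‖) ^ 2 * (x 1 / ‖x‖) ^ 2))) := fun x => by
    have h2 : √2 ^ 2 = 2 := Real.sq_sqrt (by norm_num)
    rw [LinearIsometryEquiv.norm_map, diagonalIsometry_apply]
    simp only [Matrix.cons_val_zero, Matrix.cons_val_one, div_pow, h2]
    ring
  simp only [hd'] at hd
  rw [setIntegral_radial_add hF (G := fun n => 1 / 4 * n 0 ^ 4)
      (H := fun n => 1 / 4 * n 1 ^ 4 + -1 / 2 * (n 0 ^ 2 * n 1 ^ 2)) (by fun_prop) (by fun_prop),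
    setIntegral_radial_add hF (G := fun n => 1 / 4 * n 1 ^ 4)
      (H := fun n => -1 / 2 * (n 0 ^ 2 * n 1 ^ 2)) (by fun_prop) (by fun_prop),
    setIntegral_radial_const_mul (1 / 4) fun n => n 0 ^ 4,
    setIntegral_radial_const_mul (1 / 4) fun n => n 1 ^ 4,
    setIntegral_radial_const_mul (-1 / 2) fun n => n 0 ^ 2 * n 1 ^ 2] at hd
  have e0 : Equiv.swap (1 : Fin 3) 2 0 = 0 := by decide
  have e1 : Equiv.swap (0 : Fin 3) 2 1 = 1 := by decide
  simp only [Equiv.swap_apply_right, Equiv.swap_apply_left, e0, e1, mul_one] at a0 a1 b0 b1 hs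
  linarith

/-- The deviation of the squared direction cosine from its mean. -/
noncomputable def axialCosine (x : Space) : ℝ := (x 2 / ‖x‖) ^ 2 - 1 / 3

lemma setIntegral_axialCosine (hF : IntegrableOn (fun x : Space => F ‖x‖) (droplet R)) :
    ∫ x in droplet R, F ‖x‖ * axialCosine x = 0 := by
  have h := setIntegral_radial_add hF (G := fun n => n 2 ^ 2) (H := fun _ => -1 / 3)
    (by fun_prop) (by fun_prop)
  rw [setIntegral_sq hF, integral_mul_const] at h
  simp only [axialCosine, sub_eq_add_neg, ← neg_div]
  rw [h]; ring

lemma setIntegral_axialCosine_sq (hF : IntegrableOn (fun x : Space => F ‖x‖) (droplet R)) :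
    ∫ x in droplet R, F ‖x‖ * axialCosine x ^ 2 = 4 / 45 * ∫ x in droplet R, F ‖x‖ := by
  have h := setIntegral_radial_add hF (G := fun n => n 2 ^ 4)
    (H := fun n => -2 / 3 * n 2 ^ 2 + 1 / 9) (by fun_prop) (by fun_prop)
  rw [setIntegral_radial_add hF (G := fun n => -2 / 3 * n 2 ^ 2) (H := fun _ => 1 / 9)
    (by fun_prop) (by fun_prop), setIntegral_radial_const_mul (-2 / 3) fun n => n 2 ^ 2,
    setIntegral_sq hF, setIntegral_fourth hF, integral_mul_const] at h
  rw [show (fun x : Space => F ‖x‖ * axialCosine x ^ 2) = fun x => F ‖x‖ * ((x 2 / ‖x‖) ^ 4 +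
    (-2 / 3 * (x 2 / ‖x‖) ^ 2 + 1 / 9)) by ext x; rw [axialCosine]; ring, h]
  ring

lemma integrableOn_axialCosine_pow (hF : IntegrableOn (fun x : Space => F ‖x‖) (droplet R))
    (m : ℕ) : IntegrableOn (fun x => F ‖x‖ * axialCosine x ^ m) (droplet R) :=
  integrableOn_radial_mul hF (G := fun n => (n 2 ^ 2 - 1 / 3) ^ m) (by fun_prop)

end Averages

/-! ### Traces and gradient of a perturbed uniaxial tensor. -/

section Traces

variable (A w : ℝ) {n : Fin 3 → ℝ}

lemma trace_sq_uniaxial_add (hn : n 0 ^ 2 + n 1 ^ 2 + n 2 ^ 2 = 1) :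
    ((A • (Matrix.vecMulVec n n - (1 / 3 : ℝ) • (1 : Mat)) + w • axialTensor) ^ 2).trace =
      2 / 3 * A ^ 2 + 2 / 3 * w ^ 2 + 2 * A * w * (n 2 ^ 2 - 1 / 3) := by
  simp [pow_two, Matrix.trace_fin_three, Matrix.mul_apply, Fin.sum_univ_three, axialTensor,
    Matrix.vecMulVec_apply, Matrix.one_apply]
  linear_combination (A ^ 2 * (n 0 ^ 2 + n 1 ^ 2 + n 2 ^ 2 + 1) - 2 / 3 * (A + w) * A) * hn

lemma trace_cube_uniaxial_add (hn : n 0 ^ 2 + n 1 ^ 2 + n 2 ^ 2 = 1) :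
    ((A • (Matrix.vecMulVec n n - (1 / 3 : ℝ) • (1 : Mat)) + w • axialTensor) ^ 3).trace =
      2 / 9 * A ^ 3 + 2 / 9 * w ^ 3 + (A ^ 2 * w + A * w ^ 2) * (n 2 ^ 2 - 1 / 3) := by
  simp [pow_succ, Matrix.trace_fin_three, Matrix.mul_apply, Fin.sum_univ_three, axialTensor,
    Matrix.vecMulVec_apply, Matrix.one_apply]
  linear_combination (A ^ 3 * ((n 0 ^ 2 + n 1 ^ 2 + n 2 ^ 2) ^ 2
    + (n 0 ^ 2 + n 1 ^ 2 + n 2 ^ 2) + 1)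
    + 3 * A ^ 2 * w * n 2 ^ 2 - (A + w) * A ^ 2 * (n 0 ^ 2 + n 1 ^ 2 + n 2 ^ 2 + 1)
    + (A + w) ^ 2 / 3 * A) * hn

end Traces

lemma radialTensor_eq {x : Space} : radialTensor x =
    Matrix.vecMulVec (fun i => x i / ‖x‖) (fun i => x i / ‖x‖) - (1 / 3 : ℝ) • (1 : Mat) := by
  rw [radialTensor]
  congr 1
  ext i j
  simp only [Matrix.smul_apply, Matrix.vecMulVec_apply, smul_eq_mul]
  ring

lemma axialTensor_apply (i j : Fin 3) : axialTensor i j =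
    if i = j then (if i = 2 then 2 / 3 else -1 / 3) else 0 := by
  fin_cases i <;> fin_cases j <;> simp [axialTensor] <;> norm_num

/-- The radial derivative of `h(|x|) N(x)` is `h'(|x|) N(x)`. -/
lemma sum_radialPartial_mul {x : Space} (hx : x ≠ 0) (h : ℝ → ℝ) (i j : Fin 3) :
    ∑ k, radialPartial h (fun y => radialTensor y i j) k x * (x k / ‖x‖)
      = deriv h ‖x‖ * radialTensor x i j := by
  have hn : ‖x‖ ≠ 0 := norm_ne_zero_iff.2 hx
  have hs : x 0 ^ 2 + x 1 ^ 2 + x 2 ^ 2 = ‖x‖ ^ 2 := by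
    rw [EuclideanSpace.real_norm_sq_eq, Fin.sum_univ_three]
  have h1 : ∑ k, partialDeriv k (fun y => radialTensor y i j) x * (x k / ‖x‖) = 0 := by
    simp only [partialDeriv_radialTensor hx]
    have e : ∀ k, (((if i = k then x j else 0) + (if j = k then x i else 0)) / ‖x‖ ^ 2
        - 2 * x i * x j * x k / ‖x‖ ^ 4) * (x k / ‖x‖) =
        (if i = k then x j * x k else 0) / ‖x‖ ^ 3 + (if j = k then x i * x k else 0) / ‖x‖ ^ 3
          - 2 * x i * x j / ‖x‖ ^ 5 * x k ^ 2 := fun k => by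
      split_ifs <;> field_simp <;> ring
    simp only [e, Finset.sum_sub_distrib, Finset.sum_add_distrib, ← Finset.sum_div,
      Finset.sum_ite_eq, Finset.mem_univ, if_true, ← Finset.mul_sum]
    rw [Fin.sum_univ_three, hs]
    field_simp
    ring
  have h2 := sum_sq_div_norm hx
  have e : ∀ k, radialPartial h (fun y => radialTensor y i j) k x * (x k / ‖x‖) =
      deriv h ‖x‖ * radialTensor x i j * (x k / ‖x‖) ^ 2 +
        h ‖x‖ * (partialDeriv k (fun y => radialTensor y i j) x * (x k / ‖x‖)) := fun k => by
    rw [radialPartial]; ring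
  simp only [e, Finset.sum_add_distrib, ← Finset.mul_sum, h1]
  rw [Fin.sum_univ_three, h2]
  ring

lemma sum_axialTensor_sq : ∑ i, ∑ j, axialTensor i j ^ 2 = 2 / 3 := by
  simp [axialTensor_apply, Fin.sum_univ_three]
  norm_num

lemma sum_axialTensor_mul_radialTensor {x : Space} (hx : x ≠ 0) :
    ∑ i, ∑ j, axialTensor i j * radialTensor x i j = axialCosine x := by
  have h2 := sum_sq_div_norm hx
  simp [axialTensor_apply, Fin.sum_univ_three, radialTensor_eq, Matrix.vecMulVec_apply,
    axialCosine]
  linear_combination -h2 / 3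

/-- The gradient of the perturbed state, up to the factor `√(3/2)` denoted `a`. -/
lemma sum_gradient_sq {x : Space} (hx : x ≠ 0) (a w' : ℝ) (h : ℝ → ℝ) :
    ∑ i, ∑ j, ∑ k, (a * radialPartial h (fun y => radialTensor y i j) k x
        + axialTensor i j * (w' * (x k / ‖x‖))) ^ 2 =
      (∑ i, ∑ j, ∑ k, (a * radialPartial h (fun y => radialTensor y i j) k x) ^ 2)
        + 2 * a * deriv h ‖x‖ * w' * axialCosine x + 2 / 3 * w' ^ 2 := by
  have h2 := sum_sq_div_norm hx
  have e : ∀ i j, ∑ k, (a * radialPartial h (fun y => radialTensor y i j) k x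
        + axialTensor i j * (w' * (x k / ‖x‖))) ^ 2 =
      ∑ k, (a * radialPartial h (fun y => radialTensor y i j) k x) ^ 2 +
        2 * a * deriv h ‖x‖ * w' * (axialTensor i j * radialTensor x i j)
        + w' ^ 2 * axialTensor i j ^ 2 := fun i j => by
    -- The gradient of `w` is radial, so the cross term sees only the radial derivative of the
    -- hedgehog, which is `h'` times the radial tensor.
    have h1 := sum_radialPartial_mul hx h i j
    rw [Fin.sum_univ_three] at h1 ⊢
    rw [Fin.sum_univ_three]
    linear_combination 2 * a * w' * axialTensor i j * h1 + w' ^ 2 * axialTensor i j ^ 2 * h2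
  simp only [e, Finset.sum_add_distrib, ← Finset.mul_sum, sum_axialTensor_sq,
    sum_axialTensor_mul_radialTensor hx]
  ring

/-! ### Admissibility and energy of the perturbed hedgehog. -/

/-- The hedgehog with profile `h` perturbed along `z ⊗ z - I / 3` with amplitude `w`. -/
noncomputable def perturbedState (h w : ℝ → ℝ) (x : Space) : Mat :=
  hedgehog h x + w ‖x‖ • axialTensor

lemma perturbedState_apply (h w : ℝ → ℝ) (x : Space) (i j : Fin 3) :
    perturbedState h w x i j = √(3 / 2) * (h ‖x‖ * radialTensor x i j)
      + axialTensor i j * (w ‖x‖ * 1) := by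
  simp only [perturbedState, hedgehog, Matrix.add_apply, Matrix.smul_apply, smul_eq_mul]
  ring

lemma radialPartial_const (w : ℝ → ℝ) (c : ℝ) (k : Fin 3) (x : Space) :
    radialPartial w (fun _ => c) k x = deriv w ‖x‖ * (x k / ‖x‖) * c := by
  simp [radialPartial, partialDeriv]

lemma isWeakPartial_perturbedState {R : ℝ} (hR : 0 < R) {h w : ℝ → ℝ} (hh : IsProfile R h)
    (hw : IsProfile R w) (i j k : Fin 3) :
    IsWeakPartial (droplet R) k (fun x => perturbedState h w x i j)
      fun x => √(3 / 2) * radialPartial h (fun y => radialTensor y i j) k x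
        + axialTensor i j * (deriv w ‖x‖ * (x k / ‖x‖)) := by
  have hN := isAngular_radialTensor i j
  have h1 := isAngular_const 1
  convert ((isWeakPartial_radial_mul hR hh hN k).const_smul √(3 / 2)).add
    ((memLp_radial_mul hR hh hN).const_smul _) ((memLp_radial_mul hR hw h1).const_smul _)
    ((isWeakPartial_radial_mul hR hw h1 k).const_smul (axialTensor i j)) using 1
  · ext x; exact perturbedState_apply h w x i j
  · ext x
    simp only [Pi.add_apply, Pi.smul_apply, smul_eq_mul, radialPartial_const, mul_one]

lemma memLp_perturbedState {R : ℝ} (hR : 0 < R) {h w : ℝ → ℝ} (hh : IsProfile R h)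
    (hw : IsProfile R w) (i j : Fin 3) :
    MemLp (fun x => perturbedState h w x i j) 2 (volume.restrict (droplet R)) := by
  convert ((memLp_radial_mul hR hh (isAngular_radialTensor i j)).const_smul √(3 / 2)).add
    ((memLp_radial_mul hR hw (isAngular_const 1)).const_smul (axialTensor i j)) using 1
  ext x; exact perturbedState_apply h w x i j

/-- The difference from the boundary extension has the profiles `h - 1` and `w`, both vanishing at
`R`, against angular functions; it is thus a limit of test functions. -/
lemma perturbedState_mem_admissible {R : ℝ} (hR : 0 < R) {h w : ℝ → ℝ} (hh : IsProfile R h)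
    (hw : IsProfile R w) (hhR : h R = 1) (hwR : w R = 0) :
    perturbedState h w ∈ admissible R := by
  refine ⟨fun i j => ⟨memLp_perturbedState hR hh hw i j, fun k =>
    ⟨_, isWeakPartial_perturbedState hR hh hw i j k⟩⟩, ?_, fun i j => ?_⟩
  · filter_upwards [ae_ne_zero_droplet R] with x hx
    have hs := sum_sq_div_norm hx
    constructor
    · ext i j
      rw [Matrix.transpose_apply, perturbedState_apply, perturbedState_apply, radialTensor_apply,
        radialTensor_apply, axialTensor_apply, axialTensor_apply, mul_comm (x j)]
      rcases eq_or_ne i j with rfl | hij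
      · rfl
      · simp [hij, hij.symm]
    · rw [Matrix.trace_fin_three]
      simp only [perturbedState_apply, radialTensor_eq, axialTensor_apply, Matrix.sub_apply,
        Matrix.vecMulVec_apply, Matrix.smul_apply, Matrix.one_apply, smul_eq_mul]
      generalize √(3 / 2) = a
      simp
      linear_combination a * h ‖x‖ * hs
  · have hN := isAngular_radialTensor i j
    have t1 := (isTestLimit_radial_mul hR (hh.sub_const 1) (by simp [hhR]) hN).const_smul √(3 / 2)
    have t2 := (isTestLimit_radial_mul hR hw hwR (isAngular_const 1)).const_smul (axialTensor i j)
    have t3 : MemW12Zero (droplet R) _ := (t1.add t2).memW12Zero Metric.isOpen_ball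
    convert t3 using 1
    ext x
    rw [perturbedState_apply]
    simp only [hedgehog, Matrix.smul_apply, smul_eq_mul, Pi.add_apply, Pi.smul_apply]
    ring

lemma integrableOn_sum_radialPartial_sq {R : ℝ} (hR : 0 < R) {h : ℝ → ℝ}
    (hh : IsProfile R h) : IntegrableOn (fun x => ∑ i, ∑ j, ∑ k,
    (√(3 / 2) * radialPartial h (fun y => radialTensor y i j) k x) ^ 2) (droplet R) :=
  integrable_finsetSum _ fun i _ => integrable_finsetSum _ fun j _ =>
    integrable_finsetSum _ fun k _ =>
    ((memLp_radialPartial hR hh (isAngular_radialTensor i j) k).const_mul _).integrable_sq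

/-- The angular mean of the bulk energy density and the quadratic part of the elastic energy, as
coefficients of `1`, `τ`, `τ²` with `τ = (x₂ / |x|)² - 1 / 3`. Here `A = √(3/2) h`. -/
noncomputable def densityZero (t A w w' : ℝ) : ℝ :=
  1 / 3 * w' ^ 2 - 1 / 2 * (2 / 3 * A ^ 2 + 2 / 3 * w ^ 2)
    - √6 * hPlus t / t * (2 / 9 * A ^ 3 + 2 / 9 * w ^ 3)
    + hPlus t ^ 2 / (2 * t) * (2 / 3 * A ^ 2 + 2 / 3 * w ^ 2) ^ 2

/-- The coefficient of `τ` in the energy density. -/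
noncomputable def densityOne (t A w A' w' : ℝ) : ℝ :=
  A' * w' - A * w - √6 * hPlus t / t * (A ^ 2 * w + A * w ^ 2)
    + hPlus t ^ 2 / (2 * t) * (2 * (2 / 3 * A ^ 2 + 2 / 3 * w ^ 2) * (2 * A * w))

/-- The coefficient of `τ²` in the energy density. -/
noncomputable def densityTwo (t A w : ℝ) : ℝ :=
  hPlus t ^ 2 / (2 * t) * (2 * A * w) ^ 2

lemma energy_perturbedState_eq_integral {t R : ℝ} (hR : 0 < R) {h w : ℝ → ℝ}
    (hh : IsProfile R h) (hw : IsProfile R w) :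
    energy t R (perturbedState h w) = ∫ x in droplet R,
      (1 / 2 * (∑ i, ∑ j, ∑ k,
          (√(3 / 2) * radialPartial h (fun y => radialTensor y i j) k x) ^ 2)
        + (densityZero t (√(3 / 2) * h ‖x‖) (w ‖x‖) (deriv w ‖x‖)
        + (densityOne t (√(3 / 2) * h ‖x‖) (w ‖x‖) (√(3 / 2) * deriv h ‖x‖) (deriv w ‖x‖)
            * axialCosine x
        + densityTwo t (√(3 / 2) * h ‖x‖) (w ‖x‖) * axialCosine x ^ 2))) := by
  have hwp : ∀ᵐ x ∂volume.restrict (droplet R), ∀ i j k,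
      weakPartial (droplet R) k (fun y => perturbedState h w y i j) x =
        √(3 / 2) * radialPartial h (fun y => radialTensor y i j) k x
          + axialTensor i j * (deriv w ‖x‖ * (x k / ‖x‖)) :=
    ae_all_iff.2 fun i => ae_all_iff.2 fun j => ae_all_iff.2 fun k =>
      (isWeakPartial_perturbedState hR hh hw i j k).weakPartial_ae_eq Metric.isOpen_ball
  refine integral_congr_ae ?_
  filter_upwards [hwp, ae_ne_zero_droplet R] with x hx hx0
  have hn := sum_sq_div_norm hx0
  have hg := sum_gradient_sq hx0 √(3 / 2) (deriv w ‖x‖) h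
  simp only [← hx] at hg
  rw [← gradSq] at hg
  have hP : perturbedState h w x = (√(3 / 2) * h ‖x‖) • (Matrix.vecMulVec (fun i => x i / ‖x‖)
      (fun i => x i / ‖x‖) - (1 / 3 : ℝ) • (1 : Mat)) + w ‖x‖ • axialTensor := by
    rw [perturbedState, hedgehog, radialTensor_eq]
  have h2 := trace_sq_uniaxial_add (n := fun i => x i / ‖x‖) (√(3 / 2) * h ‖x‖) (w ‖x‖) hn
  have h3 := trace_cube_uniaxial_add (n := fun i => x i / ‖x‖) (√(3 / 2) * h ‖x‖) (w ‖x‖) hn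
  rw [← hP] at h2 h3
  rw [hg, h2, h3]
  simp only [densityZero, densityOne, densityTwo, axialCosine]
  ring

/-- The energy of a perturbed hedgehog, with the angular integration carried out. -/
lemma energy_perturbedState {t R : ℝ} (hR : 0 < R) {h w : ℝ → ℝ}
    (hh : IsProfile R h) (hw : IsProfile R w) :
    IntegrableOn (fun r => r ^ 2 * (densityZero t (√(3 / 2) * h r) (w r) (deriv w r)
        + 4 / 45 * densityTwo t (√(3 / 2) * h r) (w r))) (Ioo 0 R) ∧
    energy t R (perturbedState h w) = (∫ x in droplet R, 1 / 2 * (∑ i, ∑ j, ∑ k,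
          (√(3 / 2) * radialPartial h (fun y => radialTensor y i j) k x) ^ 2)) +
      sphereArea.toReal * ∫ r in Ioo 0 R,
        r ^ 2 * (densityZero t (√(3 / 2) * h r) (w r) (deriv w r)
          + 4 / 45 * densityTwo t (√(3 / 2) * h r) (w r)) := by
  have ch := hh.continuousOn hR
  have cw := hw.continuousOn hR
  have mh : MemLp (fun r => r * (√(3 / 2) * deriv h r)) 2 (volume.restrict (Ioo 0 R)) :=
    memLp_id_mul (hh.2.const_mul _)
  have mw := memLp_id_mul hw.2
  have i0 : IntegrableOn (fun r => r ^ 2 * densityZero t (√(3 / 2) * h r) (w r) (deriv w r))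
      (Ioo 0 R) := by
    have a : IntegrableOn (fun r => r ^ 2 * densityZero t (√(3 / 2) * h r) (w r) 0) (Ioo 0 R) :=
      integrableOn_Ioo_of_continuousOn (by unfold densityZero; fun_prop)
    refine ((mw.integrable_sq.const_mul (1 / 3)).add a).congr (.of_forall fun r => ?_)
    simp only [densityZero, Pi.add_apply]
    ring
  have i1 : IntegrableOn (fun r => r ^ 2 * densityOne t (√(3 / 2) * h r) (w r)
      (√(3 / 2) * deriv h r) (deriv w r)) (Ioo 0 R) := by
    have a : IntegrableOn (fun r => r ^ 2 * densityOne t (√(3 / 2) * h r) (w r) 0 0) (Ioo 0 R) :=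
      integrableOn_Ioo_of_continuousOn (by unfold densityOne; fun_prop)
    refine ((mh.integrable_mul mw).add a).congr (.of_forall fun r => ?_)
    simp only [densityOne, Pi.add_apply, Pi.mul_apply]
    ring
  have i2 : IntegrableOn (fun r => r ^ 2 * densityTwo t (√(3 / 2) * h r) (w r)) (Ioo 0 R) :=
    integrableOn_Ioo_of_continuousOn (by unfold densityTwo; fun_prop)
  have j0 := integrable_comp_norm.2 i0
  have j1 := integrable_comp_norm.2 i1
  have j2 := integrable_comp_norm.2 i2
  have k1 := integrableOn_axialCosine_pow (F := fun r => densityOne t (√(3 / 2) * h r) (w r)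
    (√(3 / 2) * deriv h r) (deriv w r)) j1 1
  have k2 := integrableOn_axialCosine_pow (F := fun r => densityTwo t (√(3 / 2) * h r) (w r)) j2 2
  simp only [pow_one] at k1
  have iS := (integrableOn_sum_radialPartial_sq hR hh).const_mul (1 / 2)
  have mh' := hh.aestronglyMeasurable hR
  have mw' := hw.aestronglyMeasurable hR
  have e0 := integral_comp_norm (R := R)
    (F := fun r => densityZero t (√(3 / 2) * h r) (w r) (deriv w r)) (by
      have := (measurable_deriv w).aestronglyMeasurable (μ := volume.restrict (Ioo 0 R))
      unfold densityZero; fun_prop)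
  have e2 := integral_comp_norm (R := R)
    (F := fun r => densityTwo t (√(3 / 2) * h r) (w r)) (by unfold densityTwo; fun_prop)
  have es : (fun r => r ^ 2 * (densityZero t (√(3 / 2) * h r) (w r) (deriv w r)
        + 4 / 45 * densityTwo t (√(3 / 2) * h r) (w r))) = fun r =>
      r ^ 2 * densityZero t (√(3 / 2) * h r) (w r) (deriv w r)
        + 4 / 45 * (r ^ 2 * densityTwo t (√(3 / 2) * h r) (w r)) := by
    ext r; ring
  rw [es]
  refine ⟨i0.add (i2.const_mul _), ?_⟩
  rw [energy_perturbedState_eq_integral hR hh hw]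
  -- The gradient term of the unperturbed hedgehog is left unevaluated: it does not involve `w` and
  -- cancels when two amplitudes are compared.
  have s1 := integral_add iS (j0.add (k1.add k2))
  have s2 := integral_add j0 (k1.add k2)
  have s3 := integral_add k1 k2
  have s4 := integral_add i0 (i2.const_mul (4 / 45))
  simp only [Pi.add_apply] at s1 s2 s3 s4
  rw [integral_const_mul] at s4
  rw [s1, s2, s3, s4, setIntegral_axialCosine
    (F := fun r => densityOne t (√(3 / 2) * h r) (w r) (√(3 / 2) * deriv h r) (deriv w r)) j1,
    setIntegral_axialCosine_sq (F := fun r => densityTwo t (√(3 / 2) * h r) (w r)) j2, e0, e2]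
  ring

/-! ### The trial amplitude and its one-dimensional integral. -/

/-- The amplitude of the perturbation, supported in `[0, 10]`. -/
noncomputable def amplitude (r : ℝ) : ℝ := 1 / (r ^ 2 + 12) ^ 2 * max (1 - r / 10) 0

lemma biaxialState_eq (h : ℝ → ℝ) : biaxialState h 10 = perturbedState h amplitude := by
  ext1 x
  rw [biaxialState, perturbedState]
  split_ifs with hx
  · rw [amplitude, max_eq_left (by linarith)]
  · rw [amplitude, max_eq_right (by linarith)]; simp

lemma hedgehog_eq (h : ℝ → ℝ) : hedgehog h = perturbedState h fun _ => 0 := by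
  ext1 x; simp [perturbedState]

/-- The derivative of the amplitude on `(0, 10)`. -/
noncomputable def amplitudeSlope (r : ℝ) : ℝ :=
  -((r ^ 2 + 12) / 10 + 4 * r * (1 - r / 10)) / (r ^ 2 + 12) ^ 3

lemma hasDerivAt_amplitude {r : ℝ} (hr : r < 10) : HasDerivAt amplitude (amplitudeSlope r) r := by
  have h1 : HasDerivAt (fun r : ℝ => r ^ 2) (2 * r) r := by simpa using hasDerivAt_pow 2 r
  have h2 : HasDerivAt (fun r : ℝ => 1 - r / 10) (-(1 / 10)) r :=
    ((hasDerivAt_id r).div_const 10).const_sub 1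
  have h := h2.div ((h1.add_const 12).pow 2) (by simp only [Pi.pow_apply]; positivity)
  refine (h.congr_deriv ?_).congr_of_eventuallyEq ?_
  · simp only [amplitudeSlope, Pi.pow_apply]
    field_simp
    push_cast
    ring
  · filter_upwards [Iio_mem_nhds hr] with y hy
    have hy : y < 10 := hy
    rw [amplitude, max_eq_left (by linarith)]
    simp only [Pi.div_apply, Pi.pow_apply]
    ring

lemma amplitude_of_ge {r : ℝ} (hr : 10 ≤ r) : amplitude r = 0 := by
  rw [amplitude, max_eq_right (by linarith), mul_zero]

lemma deriv_amplitude_of_gt {r : ℝ} (hr : 10 < r) : deriv amplitude r = 0 := by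
  have : amplitude =ᶠ[nhds r] fun _ => (0 : ℝ) := by
    filter_upwards [Ioi_mem_nhds hr] with y hy using amplitude_of_ge (le_of_lt hy)
  simp [this.deriv_eq]

lemma isProfile_amplitude (R : ℝ) : IsProfile R amplitude := by
  have h1 : ContDiff ℝ 1 fun r : ℝ => 1 / (r ^ 2 + 12) ^ 2 :=
    ContDiff.div (by fun_prop) (by fun_prop) fun r => by positivity
  have h2 : ContDiff ℝ 1 fun r : ℝ => 1 - r / 10 := by fun_prop
  have h3 : AbsolutelyContinuousOnInterval (fun r : ℝ => max (1 - r / 10) 0) 0 R := by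
    refine squeeze_zero (fun t => ?_) (fun t => ?_)
      (h2.contDiffOn.absolutelyContinuousOnInterval (a := 0) (b := R))
    · exact Finset.sum_nonneg fun i _ => dist_nonneg
    · refine Finset.sum_le_sum fun i _ => ?_
      rw [Real.dist_eq, Real.dist_eq]
      exact abs_max_sub_max_le_abs _ _ (0 : ℝ)
  refine ⟨h1.contDiffOn.absolutelyContinuousOnInterval.fun_mul h3, ?_⟩
  refine MemLp.of_bound (measurable_deriv _).aestronglyMeasurable 1 ?_
  have h10 : ∀ᵐ r ∂volume.restrict (Ioo 0 R), r ≠ (10 : ℝ) :=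
    ae_restrict_of_ae (by simp [ae_iff, measure_singleton])
  filter_upwards [ae_restrict_mem measurableSet_Ioo, h10] with r hr hr10
  rcases lt_or_gt_of_ne hr10 with h | h
  · rw [(hasDerivAt_amplitude h).deriv, amplitudeSlope, norm_div, norm_neg,
      Real.norm_of_nonneg (by nlinarith [hr.1, sq_nonneg r]), Real.norm_of_nonneg (by positivity),
      div_le_one (by positivity)]
    have hv : 1 ≤ r ^ 2 + 12 := by nlinarith [sq_nonneg r]
    have h4 : (r ^ 2 + 12) * 12 ^ 2 ≤ (r ^ 2 + 12) ^ 3 := by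
      rw [pow_succ' _ 2]
      gcongr
      nlinarith [sq_nonneg r]
    nlinarith [sq_nonneg (r - 2), hr.1]
  · rw [deriv_amplitude_of_gt h, norm_zero]; exact zero_le_one

lemma isProfile_zero (R : ℝ) : IsProfile R fun _ => 0 :=
  contDiff_const.isProfile

/-- The radial second variation along the amplitude, with `h` replaced by the barrier. -/
noncomputable def trialIntegrand (r : ℝ) : ℝ :=
  r ^ 2 * (amplitudeSlope r ^ 2 - 0.9999 * ((1 - r / 10) / (r ^ 2 + 12) ^ 2) ^ 2
    + 1.6268 * barrier r ^ 2 * ((1 - r / 10) / (r ^ 2 + 12) ^ 2) ^ 2)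

lemma continuous_trialIntegrand : Continuous trialIntegrand := by
  unfold trialIntegrand amplitudeSlope barrier
  fun_prop (disch := intro r; positivity)

/-- A primitive of a majorant of `trialIntegrand`. -/
noncomputable def trialPrimitive (r : ℝ) : ℝ :=
  (-1634826695 * r ^ 13 - 228309478960 * r ^ 11 + 1462850150400 * r ^ 10
    - 15810799787184 * r ^ 9 + 81998165606400 * r ^ 8 - 512964348051456 * r ^ 7
    + 1208998744473600 * r ^ 6 - 6214532238925056 * r ^ 5 + 4033894488145920 * r ^ 4
    - 18307222685798400 * r ^ 3 - 850079227576320 * r ^ 2 + 4881566354042880 * r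
    - 1457278675845120) / (36864000000000 * (r ^ 2 + 12) ^ 7)

/-- The integrand is rational, and its primitive contains a small arctangent. The added positive
multiple of `1/(r² + 12)` cancels that term, so a rational primitive suffices for an upper bound. -/
lemma hasDerivAt_trialPrimitive (r : ℝ) : HasDerivAt trialPrimitive
    (trialIntegrand r + 326965339 / 7372800000000 / (r ^ 2 + 12)) r := by
  have h1 : HasDerivAt (fun r : ℝ => r ^ 2) (2 * r) r := by simpa using hasDerivAt_pow 2 r
  have hp : HasDerivAt (fun r : ℝ => (-1634826695 * r ^ 13 - 228309478960 * r ^ 11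
      + 1462850150400 * r ^ 10 - 15810799787184 * r ^ 9 + 81998165606400 * r ^ 8
      - 512964348051456 * r ^ 7 + 1208998744473600 * r ^ 6 - 6214532238925056 * r ^ 5
      + 4033894488145920 * r ^ 4 - 18307222685798400 * r ^ 3 - 850079227576320 * r ^ 2
      + 4881566354042880 * r - 1457278675845120 : ℝ))
      (-21252747035 * r ^ 12 - 2511404268560 * r ^ 10 + 14628501504000 * r ^ 9
      - 142297198084656 * r ^ 8 + 655985324851200 * r ^ 7 - 3590750436360192 * r ^ 6
      + 7253992466841600 * r ^ 5 - 31072661194625280 * r ^ 4 + 16135577952583680 * r ^ 3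
      - 54921668057395200 * r ^ 2 - 1700158455152640 * r + 4881566354042880) r := by
    have p (c : ℝ) (n : ℕ) := (hasDerivAt_pow n r).const_mul c
    have := ((((((((((((p (-1634826695) 13).sub (p 228309478960 11)).add
      (p 1462850150400 10)).sub (p 15810799787184 9)).add (p 81998165606400 8)).sub
      (p 512964348051456 7)).add (p 1208998744473600 6)).sub (p 6214532238925056 5)).add
      (p 4033894488145920 4)).sub (p 18307222685798400 3)).sub (p 850079227576320 2)).add
      ((hasDerivAt_id r).const_mul 4881566354042880)).sub_const 1457278675845120
    refine this.congr_deriv ?_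
    simp only [Nat.cast_ofNat, Nat.add_one_sub_one]
    ring
  have h := hp.div (((h1.add_const 12).pow 7).const_mul 36864000000000)
    (by simp only [Pi.pow_apply]; positivity)
  refine h.congr_deriv ?_
  have a : r ^ 2 + 12 ≠ 0 := by positivity
  simp only [trialIntegrand, amplitudeSlope, barrier, Pi.pow_apply]
  field_simp
  push_cast
  ring

lemma integral_trialIntegrand_neg : ∫ r in Ioo 0 10, trialIntegrand r < 0 := by
  have hc : Continuous fun r : ℝ => trialIntegrand r + 326965339 / 7372800000000 / (r ^ 2 + 12) :=
    continuous_trialIntegrand.add (Continuous.div (by fun_prop) (by fun_prop)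
      fun r => by positivity)
  have h1 := intervalIntegral.integral_eq_sub_of_hasDerivAt
    (fun r _ => hasDerivAt_trialPrimitive r) (hc.intervalIntegrable 0 10)
  have h2 : ∫ r in (0 : ℝ)..10, trialIntegrand r ≤ ∫ r in (0 : ℝ)..10,
      (trialIntegrand r + 326965339 / 7372800000000 / (r ^ 2 + 12)) :=
    intervalIntegral.integral_mono_on (by norm_num)
      (continuous_trialIntegrand.intervalIntegrable _ _) (hc.intervalIntegrable _ _)
      fun r _ => le_add_of_nonneg_right (by positivity)
  rw [← integral_Ioc_eq_integral_Ioo, ← intervalIntegral.integral_of_le (by norm_num)]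
  refine (h2.trans_eq h1).trans_lt ?_
  norm_num [trialPrimitive]

/-- The change of the radial density under the perturbation, below the cutoff. -/
lemma density_sub_le {t s w w' ρ : ℝ} (ht : 200 ≤ t) (hs : |s| ≤ ρ) (hw : 0 ≤ w)
    (hw1 : w ≤ 1 / 144) :
    densityZero t (√(3 / 2) * s) w w' + 4 / 45 * densityTwo t (√(3 / 2) * s) w
      - (densityZero t (√(3 / 2) * s) 0 0 + 4 / 45 * densityTwo t (√(3 / 2) * s) 0)
      ≤ 1 / 3 * (w' ^ 2 - 0.9999 * w ^ 2 + 1.6268 * ρ ^ 2 * w ^ 2) := by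
  have hA : √(3 / 2 : ℝ) ^ 2 = 3 / 2 := Real.sq_sqrt (by norm_num)
  -- `0.2905 = (1 + 3 · 0.054)/4`.
  have hb : hPlus t ^ 2 / (2 * t) ≤ 0.2905 := by
    rw [mul_comm, ← div_div, hPlus_sq_div (by linarith)]
    linarith [hPlus_div_le ht]
  have hb0 : 0 ≤ hPlus t ^ 2 / (2 * t) := by positivity
  have h3 : 0 ≤ √6 * (hPlus t / t) * w ^ 3 := by
    have := hPlus_div_pos (t := t) (by linarith)
    positivity
  have hs2 : s ^ 2 ≤ ρ ^ 2 := sq_le_sq' (by linarith [(abs_le.1 hs).1]) (abs_le.1 hs).2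
  have hw2 : w ^ 2 ≤ (1 / 144) ^ 2 := by gcongr
  simp only [densityZero, densityTwo]
  generalize hPlus t ^ 2 / (2 * t) = b at *
  rw [mul_div_assoc]
  generalize √6 * (hPlus t / t) = k at *
  have e1 : b * (s ^ 2 * w ^ 2) ≤ 0.2905 * (ρ ^ 2 * w ^ 2) := by gcongr
  have e2 : b * (w ^ 2 * w ^ 2) ≤ 0.2905 * ((1 / 144) ^ 2 * w ^ 2) := by gcongr
  have e3 : 0 ≤ w ^ 2 := sq_nonneg w
  simp only [mul_pow, hA]
  -- With `b = h₊²/(2t)`, the mixed quartic terms total `(28/15) b s² w²`, and `3 · (28/15) · 0.2905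
  -- = 1.6268`. The term `(4/9) b w⁴` is absorbed in the loss from `1` to `0.9999` since `w ≤
  -- 1/144`. The cubic term in `w` has a favourable sign and is dropped.
  nlinarith [e1, e2, e3, h3]

lemma amplitude_of_le {r : ℝ} (hr : r ≤ 10) :
    amplitude r = (1 - r / 10) / (r ^ 2 + 12) ^ 2 := by
  rw [amplitude, max_eq_left (by linarith)]
  ring

lemma amplitude_nonneg (r : ℝ) : 0 ≤ amplitude r := by
  unfold amplitude; positivity

lemma amplitude_le {r : ℝ} (hr : 0 ≤ r) : amplitude r ≤ 1 / 144 := by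
  have h1 : 1 / (r ^ 2 + 12) ^ 2 ≤ 1 / (144 : ℝ) := by
    gcongr
    nlinarith [sq_nonneg r]
  have h2 : max (1 - r / 10) 0 ≤ 1 := max_le (by linarith) zero_le_one
  calc amplitude r ≤ 1 / 144 * 1 := by unfold amplitude; gcongr
    _ = 1 / 144 := mul_one _

/-! ### The strict energy inequality and the conclusion. -/

/-- The perturbed state has strictly lower energy than the radial hedgehog. -/
theorem IsHedgehogProfile.energy_biaxialState_lt {t R : ℝ} (ht : 200 ≤ t) (hR : 10 ≤ R)
    {h : ℝ → ℝ} (hh : IsHedgehogProfile t R h) :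
    energy t R (biaxialState h 10) < energy t R (hedgehog h) := by
  have hR0 : 0 < R := by linarith
  have hp : IsProfile R h := ⟨hh.1.1, hh.1.2.1⟩
  obtain ⟨i1, e1⟩ := energy_perturbedState (t := t) hR0 hp (isProfile_amplitude R)
  obtain ⟨i0, e0⟩ := energy_perturbedState (t := t) hR0 hp (isProfile_zero R)
  have hS := ENNReal.toReal_pos sphereArea_pos.ne' sphereArea_ne_top
  rw [biaxialState_eq, hedgehog_eq, e1, e0, add_lt_add_iff_left, mul_lt_mul_iff_right₀ hS,
    ← sub_neg, ← integral_sub i1 i0]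
  -- The amplitude has a kink at `10`, which is excluded as a null set.
  have h10 : ∀ᵐ r ∂volume.restrict (Ioo 0 R), r ≠ (10 : ℝ) :=
    ae_restrict_of_ae (by simp [ae_iff, measure_singleton])
  have hle : ∀ᵐ r ∂volume.restrict (Ioo 0 R),
      r ^ 2 * (densityZero t (√(3 / 2) * h r) (amplitude r) (deriv amplitude r)
          + 4 / 45 * densityTwo t (√(3 / 2) * h r) (amplitude r))
        - r ^ 2 * (densityZero t (√(3 / 2) * h r) 0 (deriv (fun _ => (0 : ℝ)) r)
          + 4 / 45 * densityTwo t (√(3 / 2) * h r) 0)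
        ≤ (Iio 10).indicator (fun r => 1 / 3 * trialIntegrand r) r := by
    filter_upwards [ae_restrict_mem measurableSet_Ioo, h10, hh.abs_le_barrier ht hR]
      with r hr hr10 hb
    rw [deriv_const]
    rcases lt_or_gt_of_ne hr10 with hlt | hgt
    · have := density_sub_le (w' := deriv amplitude r) ht hb (amplitude_nonneg r)
        (amplitude_le hr.1.le)
      rw [indicator_of_mem (mem_Iio.2 hlt), ← mul_sub, trialIntegrand, mul_left_comm]
      refine mul_le_mul_of_nonneg_left (this.trans_eq ?_) (sq_nonneg r)
      rw [(hasDerivAt_amplitude hlt).deriv, amplitude_of_le hlt.le]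
    · rw [indicator_of_notMem (by simpa using hgt.le), deriv_amplitude_of_gt hgt,
        amplitude_of_ge hgt.le, sub_self]
  have hint : Integrable ((Iio 10).indicator fun r => 1 / 3 * trialIntegrand r)
      (volume.restrict (Ioo 0 R)) :=
    Integrable.indicator (((continuous_trialIntegrand.const_mul _).integrableOn_Icc
      (a := 0) (b := R)).mono_set Ioo_subset_Icc_self) measurableSet_Iio
  refine (integral_mono_ae (i1.sub i0) hint hle).trans_lt ?_
  rw [setIntegral_indicator measurableSet_Iio, Ioo_inter_Iio, min_eq_right hR,
    integral_const_mul]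
  linarith [integral_trialIntegrand_neg]

theorem IsHedgehogProfile.hedgehog_mem_admissible {t R : ℝ} (hR : 10 ≤ R) {h : ℝ → ℝ}
    (hh : IsHedgehogProfile t R h) : hedgehog h ∈ admissible R := by
  rw [hedgehog_eq]
  exact perturbedState_mem_admissible (by linarith) ⟨hh.1.1, hh.1.2.1⟩ (isProfile_zero R)
    hh.1.2.2 rfl

theorem IsHedgehogProfile.biaxialState_mem_admissible {t R : ℝ} (hR : 10 ≤ R) {h : ℝ → ℝ}
    (hh : IsHedgehogProfile t R h) : biaxialState h 10 ∈ admissible R := by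
  rw [biaxialState_eq]
  exact perturbedState_mem_admissible (by linarith) ⟨hh.1.1, hh.1.2.1⟩ (isProfile_amplitude R)
    hh.1.2.2 (amplitude_of_ge hR)

end LandauDeGennes

theorem mainTheorem2 :
    (∃ t₀ R₀ : ℝ, 0 < t₀ ∧ 0 < R₀ ∧ ∀ t : ℝ, t₀ ≤ t → ∀ R : ℝ, R₀ ≤ R →
      ∀ h : ℝ → ℝ, LandauDeGennes.IsHedgehogProfile t R h →
        LandauDeGennes.hedgehog h ∈ LandauDeGennes.admissible R ∧
        ¬ IsMinOn (LandauDeGennes.energy t R) (LandauDeGennes.admissible R)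
          (LandauDeGennes.hedgehog h)) ∧
    (∃ R₀ : ℝ, 10 ≤ R₀ ∧ ∀ R : ℝ, R₀ ≤ R →
      ∀ h : ℝ → ℝ, LandauDeGennes.IsHedgehogProfile 200 R h →
        LandauDeGennes.hedgehog h ∈ LandauDeGennes.admissible R ∧
        LandauDeGennes.biaxialState h 10 ∈ LandauDeGennes.admissible R ∧
        LandauDeGennes.energy 200 R (LandauDeGennes.biaxialState h 10) <
          LandauDeGennes.energy 200 R (LandauDeGennes.hedgehog h)) := by
  refine ⟨⟨200, 10, by norm_num, by norm_num, fun t ht R hR h hh => ?_⟩,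
    10, le_rfl, fun R hR h hh => ?_⟩
  · exact ⟨hh.hedgehog_mem_admissible hR, fun hmin =>
      (hh.energy_biaxialState_lt ht hR).not_ge (hmin (hh.biaxialState_mem_admissible hR))⟩
  · exact ⟨hh.hedgehog_mem_admissible hR, hh.biaxialState_mem_admissible hR,
      hh.energy_biaxialState_lt le_rfl hR⟩
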